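/- **Theorem.** Let $p>0$ and $c\ge 0$. For $n>p$ let $A_n$ be the adjacency matrix of an Erdős–Rényi random graph $G_n$ with law $\mathrm{G}(n,p/n)$ (vertices $1,\dots,n$, each pair joined by an edge with probability $p/n$, independently); the $G_n$ are defined on one probability space with arbitrary joint law. Let $D_n$ be the diagonal matrix whose $i$-th diagonal entry is $c+\sum_j (A_n)_{ij}$, except that it is $1$ if the whole $i$-th row of $A_n$ is $0$, and let $K_n=D_n^{-1}A_n$. For a real $n\times n$ matrix $M$ with real eigenvalues $\lambda_1,\dots,\lambda_n$ (with multiplicity), let $\mathrm{esd}(M)=n^{-1}\sum_{i=1}^n\delta_{\lambda_i}$ be its empirical spectral distribution. All eigenvalues of $K_n$ are real, and there is a probability measure $\mu$ on $\mathbb{R}$, depending only on $p$ and $c$, such that 1. $\mathrm{esd}(K_n)\to\mu$ weakly in probability as $n\to\infty$, i.e. $\int f\,d\,\mathrm{esd}(K_n)\to\int f\,d\mu$ in probability for every bounded continuous $f:\mathbb{R}\to\mathbb{R}$; 2. for every subsequence $n_1<n_2<\cdots$ with $\sum_j 1/n_j<\infty$, almost surely $\mathrm{esd}(K_{n_j})\to\mu$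 weakly as $j\to\infty$; 3. $\mu$ is symmetric about $0$ and nondegenerate (not a point mass); 4. for every integer $k\ge1$, $\mu$ has a finite $k$-th moment, equal to $\mathbb{E}\,r_k(T,\emptyset,c)$, where $T$ is a Galton–Watson tree with root $\emptyset$ and offspring distribution $\mathrm{Poisson}(p)$. Here, for a locally finite graph $G$ and a vertex $v_0$, $r_k(G,v_0,c)$ is the probability that the following random walk, started at $v_0$ at step $0$, is alive and at $v_0$ at step $k$: from a vertex with $d\ge1$ neighbours it moves to each neighbour with probability $1/(c+d)$ and is killed with probability $c/(c+d)$; if $v_0$ has no neighbour, the walk is killed at step $1$, whatever $c$ is. Let $J_n$ be the $n\times n$ matrix with all entries $1/n$. The eigenvalues are also real, and 1 and 2 also hold with the same $\mu$, when $K_n$ is replaced by $D_n^{-1}(cJ_n+A_n)$ or, if $c>0$, by the Markov matrix $M_n$ obtained from $cJ_n+A_n$ by dividing each row by its sum. -/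

import Mathlib

open MeasureTheory ProbabilityTheory Filter
open scoped NNReal ENNReal Topology BoundedContinuousFunction

noncomputable section

namespace RandomMarkov

/-! ### Empirical spectral distribution -/

/-- The empirical spectral distribution of a real square matrix: mass `1 / n` at each eigenvalue,
with algebraic multiplicity. The real roots of the characteristic polynomial are all the
eigenvalues as soon as this polynomial splits over `ℝ`. -/
def esd {ι : Type*} [Fintype ι] [DecidableEq ι] (M : Matrix ι ι ℝ) : Measure ℝ :=
  (Fintype.card ι : ℝ≥0∞)⁻¹ • (M.charpoly.roots.map Measure.dirac).sum

/-! ### The matrices attached to a graph -/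

open Classical in
/-- The adjacency matrix. -/
def adj {V : Type*} (G : SimpleGraph V) : Matrix V V ℝ := G.adjMatrix ℝ

/-- The diagonal of `D`: `c + deg i`, except that it is `1` if the whole `i`-th row of the
adjacency matrix vanishes. -/
def diagD {V : Type*} [Fintype V] (c : ℝ≥0) (G : SimpleGraph V) (i : V) : ℝ :=
  open Classical in if ∀ j, adj G i j = 0 then 1 else (c : ℝ) + ∑ j, adj G i j

/-- `K = D⁻¹ A`. -/
def matK {V : Type*} [Fintype V] [DecidableEq V] (c : ℝ≥0) (G : SimpleGraph V) : Matrix V V ℝ :=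
  (Matrix.diagonal (diagD c G))⁻¹ * adj G

/-- The `n × n` matrix all of whose entries are `1 / n`. -/
def matJ (V : Type*) [Fintype V] : Matrix V V ℝ :=
  Matrix.of fun _ _ => 1 / (Fintype.card V : ℝ)

/-- The row-normalized version of `X` (all row sums nonzero): divide each row by its sum. -/
def rowNormalized {V : Type*} [Fintype V] [DecidableEq V] (X : Matrix V V ℝ) : Matrix V V ℝ :=
  (Matrix.diagonal (fun i => ∑ j, X i j))⁻¹ * X

/-- The Markov matrix `M`, the row-normalized version of `c J + A` (used for `c > 0`). -/
def matM {V : Type*} [Fintype V] [DecidableEq V] (c : ℝ≥0) (G : SimpleGraph V) : Matrix V V ℝ :=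
  rowNormalized ((c : ℝ) • matJ V + adj G)

/-- The variant `D⁻¹ (c J + A)`, with the `D` of `matK`, meaningful for all `c ≥ 0`. -/
def matM' {V : Type*} [Fintype V] [DecidableEq V] (c : ℝ≥0) (G : SimpleGraph V) : Matrix V V ℝ :=
  (Matrix.diagonal (diagD c G))⁻¹ * ((c : ℝ) • matJ V + adj G)

/-! ### Random graphs -/

/-- `p / n` as an element of `[0, 1]`, for `n > p`. -/
def edgeProb (p : ℝ≥0) (n : ℕ) (h : (p : ℝ) < n) : unitInterval :=
  ⟨(p : ℝ) / n, by positivity, div_le_one_of_le₀ h.le (by positivity)⟩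

/-- Each `G n`, `n > p`, is a random graph on `n` vertices with law `G(n, p/n)`: every pair of
vertices is an edge with probability `p/n`, independently. Nothing is asked of the joint law of
`G n` for different `n`. -/
def IsErdosRenyi {Ω : Type*} [MeasurableSpace Ω] (P : Measure Ω) (p : ℝ≥0)
    (G : (n : ℕ) → Ω → SimpleGraph (Fin n)) : Prop :=
  ∀ (n : ℕ) (h : (p : ℝ) < n),
    HasLaw (G n) (SimpleGraph.binomialRandom (Fin n) (edgeProb p n h)) P

/-! ### Weak convergence of random measures -/

/-- The random measures `ν n` converge weakly in probability to `μ`. -/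
def WeaklyInProbability {Ω : Type*} [MeasurableSpace Ω] (P : Measure Ω)
    (ν : ℕ → Ω → Measure ℝ) (μ : Measure ℝ) : Prop :=
  ∀ f : ℝ →ᵇ ℝ,
    TendstoInMeasure P (fun n ω => ∫ x, f x ∂(ν n ω)) atTop (fun _ => ∫ x, f x ∂μ)

/-- Almost surely, the random measures `ν j` converge weakly to `μ`. -/
def WeaklyAlmostSurely {Ω : Type*} [MeasurableSpace Ω] (P : Measure Ω)
    (ν : ℕ → Ω → Measure ℝ) (μ : Measure ℝ) : Prop :=
  ∀ᵐ ω ∂P, ∀ f : ℝ →ᵇ ℝ,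
    Tendsto (fun j => ∫ x, f x ∂(ν j ω)) atTop (𝓝 (∫ x, f x ∂μ))

/-- For random matrices `X n` that are functions of random graphs `G n`: the spectral
distributions converge weakly to `μ` in probability, and almost surely along every subsequence
`n_j` with `∑ 1 / n_j < ∞`. -/
def EsdConverges {Ω : Type*} [MeasurableSpace Ω] (P : Measure Ω)
    (G : (n : ℕ) → Ω → SimpleGraph (Fin n))
    (X : (n : ℕ) → SimpleGraph (Fin n) → Matrix (Fin n) (Fin n) ℝ) (μ : Measure ℝ) : Prop :=
  WeaklyInProbability P (fun n ω => esd (X n (G n ω))) μ ∧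
    ∀ s : ℕ → ℕ, StrictMono s → Summable (fun j => 1 / (s j : ℝ)) →
      WeaklyAlmostSurely P (fun j ω => esd (X (s j) (G (s j) ω))) μ

/-! ### The killed random walk -/

/-- Transition weights at a vertex with `d ≥ 1` neighbours: each neighbour has probability
`1 / (c + d)`, and the walk is killed (state `none`) with probability `c / (c + d)`. -/
def stepWeight {V : Type*} (G : SimpleGraph V) (c : ℝ≥0) (v : V) : Option V → ℝ≥0∞
  | none => (c : ℝ≥0∞) / (c + (G.neighborSet v).ncard)
  | some w => open Classical in if G.Adj v w then 1 / (c + (G.neighborSet v).ncard) else 0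

theorem sum_stepWeight {V : Type*} (G : SimpleGraph V) (c : ℝ≥0) (v : V)
    (hf : (G.neighborSet v).Finite) (hn : (G.neighborSet v).Nonempty) :
    ∑ a ∈ Finset.insertNone hf.toFinset, stepWeight G c v a = 1 := by
  have hd : (G.neighborSet v).ncard ≠ 0 := ((Set.ncard_pos hf).mpr hn).ne'
  have h1 : ∑ w ∈ hf.toFinset, stepWeight G c v (some w)
      = (G.neighborSet v).ncard * (1 / ((c : ℝ≥0∞) + (G.neighborSet v).ncard)) := by
    rw [Finset.sum_congr rfl (g := fun _ => 1 / ((c : ℝ≥0∞) + (G.neighborSet v).ncard)),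
      Finset.sum_const, nsmul_eq_mul, ← Set.ncard_eq_toFinset_card _ hf]
    intro w hw
    have : G.Adj v w := by simpa using hw
    simp [stepWeight, this]
  rw [Finset.sum_insertNone, h1, stepWeight, mul_one_div, ← ENNReal.add_div]
  exact ENNReal.div_self (by simp [hd]) (by finiteness)

open Classical in
/-- One step of the walk on a locally finite graph. A walk at a vertex without neighbours is
killed, whatever `c` is; a killed walk stays killed. (Vertices with infinitely many neighbours,
which do not occur in a locally finite graph, are treated as isolated.) -/
def step {V : Type*} (G : SimpleGraph V) (c : ℝ≥0) : Option V → PMF (Option V)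
  | none => PMF.pure none
  | some v =>
    if h : (G.neighborSet v).Finite ∧ (G.neighborSet v).Nonempty then
      PMF.ofFinset (stepWeight G c v) (Finset.insertNone h.1.toFinset)
        (sum_stepWeight G c v h.1 h.2) (by
          rintro (_ | w) hw
          · simp at hw
          · have : ¬ G.Adj v w := by simpa using hw
            simp [stepWeight, this])
    else PMF.pure none

/-- The law of the state at step `k` of the walk started at `v₀`. -/
def walkLaw {V : Type*} (G : SimpleGraph V) (c : ℝ≥0) (v₀ : V) : ℕ → PMF (Option V)
  | 0 => PMF.pure (some v₀)
  | k + 1 => (walkLaw G c v₀ k).bind (step G c)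

/-- `r_k(G, v₀, c)`, the probability that the walk is alive and at `v₀` at step `k`. -/
def returnProb {V : Type*} (G : SimpleGraph V) (v₀ : V) (c : ℝ≥0) (k : ℕ) : ℝ :=
  (walkLaw G c v₀ k (some v₀)).toReal

/-! ### Galton–Watson trees -/

/-- The individuals of the Galton–Watson tree with offspring numbers `ξ`: the root is `[]`, and
the children of `v` are `i :: v`, `i < ξ v`. -/
def IsIndividual (ξ : List ℕ → ℕ) : List ℕ → Prop
  | [] => True
  | i :: v => IsIndividual ξ v ∧ i < ξ v

/-- The Galton–Watson tree with offspring numbers `ξ`: edges join individuals to their children. -/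
def gwTree (ξ : List ℕ → ℕ) : SimpleGraph {v : List ℕ // IsIndividual ξ v} where
  Adj u v := (∃ i, v.1 = i :: u.1) ∨ (∃ i, u.1 = i :: v.1)
  symm := ⟨fun _ _ h => h.symm⟩
  loopless := ⟨fun u h => by
    rcases h with ⟨i, h⟩ | ⟨i, h⟩ <;> simpa using congrArg List.length h⟩

/-- The root. -/
def gwRoot (ξ : List ℕ → ℕ) : {v : List ℕ // IsIndividual ξ v} := ⟨[], trivial⟩

/-- The trees are locally finite, so that the walk on them is the intended one. -/
theorem gwTree_neighborSet_finite (ξ : List ℕ → ℕ) (u : {v : List ℕ // IsIndividual ξ v}) :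
    ((gwTree ξ).neighborSet u).Finite := by
  apply Set.Finite.of_finite_image (f := Subtype.val) _ Subtype.val_injective.injOn
  apply ((Set.finite_singleton u.1.tail).union
    ((Set.finite_Iio (ξ u.1)).image (fun i => i :: u.1))).subset
  rintro _ ⟨v, hv, rfl⟩
  rcases hv with ⟨i, h⟩ | ⟨i, h⟩
  · right
    have := v.2
    rw [h] at this
    exact ⟨i, this.2, h.symm⟩
  · left
    simp [h]

/-- The law of i.i.d. Poisson offspring numbers with mean `p`. -/
def offspringLaw (p : ℝ≥0) : Measure (List ℕ → ℕ) :=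
  Measure.infinitePi (fun _ : List ℕ => poissonMeasure p)

/-- `r_k(T, ∅, c)` for the tree `T` with offspring numbers `ξ`. -/
def gwReturnProb (c : ℝ≥0) (k : ℕ) (ξ : List ℕ → ℕ) : ℝ :=
  returnProb (gwTree ξ) (gwRoot ξ) c k

end RandomMarkov

end

/-!
The proof is the method of moments. All the matrices in question have the form `D⁻¹ A` with `A`
symmetric and `D` a positive diagonal, hence are similar to symmetric matrices
(`Symmetrizable.splits`), and their eigenvalues lie in an interval independent of `n` because their
absolute row sums are bounded. The `k`-th moment of `esd K` is `n⁻¹ tr K ^ k`, that is, the average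
over the vertices `v` of the return probability `r_k(G, v, c)` (`trace_matK_pow`).

*Expectations.* Let `t` be a finite tree, truncated at height `h`. The ways of finding `t` as the
neighbourhood of a vertex `v` of `G(n, p/n)` correspond to families of disjoint sets of vertices, the
sets of children of the individuals of height less than `h`. Counting the families
(`exists_disjoint_families`) and bounding from below the probability of each
(`IsLabelling.le_embedEvent`) shows that the neighbourhood of `v` is `t` with probability at least
the Poisson weight `gwProb p h t` of `t`, asymptotically. A lower bound suffices: the weights of all
trees add up to `1`, and both `r_k` and `1 - r_k` are nonnegative. As `r_k` depends only on the
neighbourhood of height `k` (`returnProb_eq_of_local_iso`), `𝔼 r_k(G, v, c)` tends to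
`𝔼 r_k(T, ∅, c)`, uniformly in `v` (`eventually_abs_integral_trace_sub_le`).

*Fluctuations.* Changing the status of one pair of vertices affects two rows of `K` only, hence
changes `tr K ^ k` by at most `4 k` (`abs_trace_matK_pow_sub_le`). By the Efron–Stein inequality the
variance of `tr K ^ k` is `O(n)`, and the `k`-th moment deviates from its limit with probability
`O(1 / n)` (`prob_abs_trace_sub_ge_le`). This gives convergence in probability, and almost sure
convergence along sparse subsequences by the Borel–Cantelli lemma. The two other matrices differ
from `K` by entries `O(1 / n)`, which changes the traces of powers by `O(1)` only
(`abs_trace_pow_sub_matK_le`).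

*The limit.* On a compact interval, convergence of moments is weak convergence by Weierstrass'
theorem (`exists_moment_control`), and compactness of the set of probability measures provides a
measure with the limiting moments (`exists_limit_measure`). It is symmetric because its odd moments
vanish, trees being bipartite, and it is not `δ₀` because its second moment is positive.
-/

set_option linter.unusedSectionVars false

namespace RandomMarkov

/-! ### Spectra of symmetrizable matrices -/

section Spectrum

variable {ι : Type*} [Fintype ι] [DecidableEq ι]

theorem trace_mul_pow_comm (S T : Matrix ι ι ℝ) (k : ℕ) :
    ((S * T) ^ k).trace = ((T * S) ^ k).trace := by
  cases k with
  | zero => simp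
  | succ k =>
    have h : (S * T) ^ k * S = S * (T * S) ^ k := by
      have : SemiconjBy S (T * S) (S * T) := by simp [SemiconjBy, mul_assoc]
      exact ((this.pow_right k).eq).symm
    rw [pow_succ, ← mul_assoc, h, mul_assoc, Matrix.trace_mul_comm, mul_assoc, ← pow_succ]

theorem _root_.Matrix.IsHermitian.sum_eigenvalues_pow {H : Matrix ι ι ℝ} (hH : H.IsHermitian)
    (k : ℕ) : ∑ i, hH.eigenvalues i ^ k = (H ^ k).trace := by
  conv_rhs => rw [hH.spectral_theorem, ← map_pow, Unitary.conjStarAlgAut_apply,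
    Matrix.trace_mul_comm, ← mul_assoc]
  simp [Matrix.diagonal_pow, Matrix.trace]

/-- `D⁻¹ A` has the same characteristic polynomial and the same traces of powers as the symmetric
matrix `D^{-1/2} A D^{-1/2}`. -/
theorem exists_hermitian_of_diagonal_inv_mul {d : ι → ℝ} (hd : ∀ i, 0 < d i) {A : Matrix ι ι ℝ}
    (hA : A.IsSymm) : ∃ H : Matrix ι ι ℝ, H.IsHermitian ∧
      ((Matrix.diagonal d)⁻¹ * A).charpoly = H.charpoly ∧
      ∀ k, (((Matrix.diagonal d)⁻¹ * A) ^ k).trace = (H ^ k).trace := by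
  set S : Matrix ι ι ℝ := Matrix.diagonal fun i => √(d i)⁻¹
  have hS : (Matrix.diagonal d)⁻¹ = S * S := by
    rw [Matrix.diagonal_mul_diagonal]
    apply Matrix.inv_eq_left_inv
    rw [Matrix.diagonal_mul_diagonal, ← Matrix.diagonal_one]
    congr 1
    ext i
    rw [Real.mul_self_sqrt (inv_nonneg.2 (hd i).le), inv_mul_cancel₀ (hd i).ne']
  refine ⟨S * A * S, ?_, ?_, fun k => ?_⟩
  · rw [Matrix.IsHermitian, Matrix.conjTranspose_eq_transpose_of_trivial, Matrix.transpose_mul,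
      Matrix.transpose_mul, hA.eq, Matrix.diagonal_transpose, mul_assoc]
  · rw [hS, mul_assoc, Matrix.charpoly_mul_comm]
  · rw [hS, mul_assoc, trace_mul_pow_comm]

/-- The absolute row sums of `M` are at most `B`. -/
def RowBdd (M : Matrix ι ι ℝ) (B : ℝ) : Prop := ∀ i, ∑ j, |M i j| ≤ B

theorem RowBdd.abs_le {M : Matrix ι ι ℝ} {B : ℝ} (h : RowBdd M B) (i j : ι) : |M i j| ≤ B :=
  (Finset.single_le_sum (f := fun j => |M i j|) (fun _ _ => abs_nonneg _)
    (Finset.mem_univ j)).trans (h i)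

theorem RowBdd.mul {M N : Matrix ι ι ℝ} {a b : ℝ} (hM : RowBdd M a) (hN : RowBdd N b)
    (hb : 0 ≤ b) : RowBdd (M * N) (a * b) := fun i => calc
  ∑ j, |(M * N) i j| ≤ ∑ j, ∑ l, |M i l| * |N l j| := by
    gcongr with j
    rw [Matrix.mul_apply]
    exact (Finset.abs_sum_le_sum_abs _ _).trans_eq (by simp_rw [abs_mul])
  _ = ∑ l, |M i l| * ∑ j, |N l j| := by
    rw [Finset.sum_comm]; simp_rw [Finset.mul_sum]
  _ ≤ ∑ l, |M i l| * b := by gcongr with l; exact hN l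
  _ ≤ a * b := by rw [← Finset.sum_mul]; gcongr; exact hM i

theorem RowBdd.one : RowBdd (1 : Matrix ι ι ℝ) 1 := fun i => by
  simp [Matrix.one_apply, apply_ite]

theorem RowBdd.pow {M : Matrix ι ι ℝ} {a : ℝ} (hM : RowBdd M a) (ha : 0 ≤ a) (k : ℕ) :
    RowBdd (M ^ k) (a ^ k) := by
  induction k with
  | zero => simpa using RowBdd.one
  | succ k ih => rw [pow_succ, pow_succ]; exact ih.mul hM ha

theorem RowBdd.mono {M : Matrix ι ι ℝ} {a b : ℝ} (hM : RowBdd M a) (h : a ≤ b) : RowBdd M b :=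
  fun i => (hM i).trans h

/-- By Gershgorin's theorem. -/
theorem RowBdd.abs_root_le {M : Matrix ι ι ℝ} {B : ℝ} (hM : RowBdd M B) {x : ℝ}
    (hx : x ∈ M.charpoly.roots) : |x| ≤ B := by
  have h1 : Module.End.HasEigenvalue (Matrix.toLin' M) x := by
    rw [Module.End.hasEigenvalue_iff_isRoot_charpoly, Matrix.charpoly_toLin']
    exact (Polynomial.mem_roots'.1 hx).2
  obtain ⟨i, hi⟩ := eigenvalue_mem_ball h1
  rw [mem_closedBall_iff_norm, Real.norm_eq_abs] at hi
  have h2 := hM i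
  rw [← Finset.add_sum_erase _ _ (Finset.mem_univ i)] at h2
  simp only [Real.norm_eq_abs] at hi
  have := abs_sub_abs_le_abs_sub x (M i i)
  linarith

/-- A real matrix of the form `D⁻¹ A`, with `D` a positive diagonal and `A` a symmetric matrix. -/
def Symmetrizable (M : Matrix ι ι ℝ) : Prop :=
  ∃ (d : ι → ℝ) (A : Matrix ι ι ℝ), (∀ i, 0 < d i) ∧ A.IsSymm ∧ M = (Matrix.diagonal d)⁻¹ * A

theorem Symmetrizable.splits {M : Matrix ι ι ℝ} (h : Symmetrizable M) : M.charpoly.Splits := by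
  obtain ⟨d, A, hd, hA, rfl⟩ := h
  obtain ⟨H, hH, h1, -⟩ := exists_hermitian_of_diagonal_inv_mul hd hA
  rw [h1]
  exact hH.splits_charpoly

theorem Symmetrizable.exists_eigenvalues {M : Matrix ι ι ℝ} (h : Symmetrizable M) :
    ∃ x : ι → ℝ, M.charpoly.roots = Finset.univ.val.map x ∧
      ∀ k, ∑ i, x i ^ k = (M ^ k).trace := by
  obtain ⟨d, A, hd, hA, rfl⟩ := h
  obtain ⟨H, hH, h1, h2⟩ := exists_hermitian_of_diagonal_inv_mul hd hA
  refine ⟨hH.eigenvalues, ?_, fun k => ?_⟩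
  · rw [h1, hH.roots_charpoly_eq_eigenvalues]
    rfl
  · rw [h2, hH.sum_eigenvalues_pow]

/-- The empirical spectral distribution of a symmetrizable matrix is carried by any interval
`[-B, B]` such that `B` bounds the absolute row sums, and its moments are traces of powers. -/
theorem Symmetrizable.esd_spec [Nonempty ι] {M : Matrix ι ι ℝ} (h : Symmetrizable M) {B : ℝ}
    (hB : RowBdd M B) : IsProbabilityMeasure (esd M) ∧ esd M (Set.Icc (-B) B)ᶜ = 0 ∧
      ∀ k : ℕ, ∫ x, x ^ k ∂(esd M) = (M ^ k).trace / Fintype.card ι := by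
  obtain ⟨x, hx, hk⟩ := h.exists_eigenvalues
  have he : esd M = (Fintype.card ι : ℝ≥0∞)⁻¹ • ∑ i, Measure.dirac (x i) := by
    rw [esd, hx, Multiset.map_map]; rfl
  have hc : (Fintype.card ι : ℝ≥0∞) ≠ 0 := by simp
  refine ⟨⟨?_⟩, ?_, fun k => ?_⟩
  · rw [he]
    simp [ENNReal.inv_mul_cancel hc]
  · rw [he, Measure.smul_apply, Measure.finsetSum_apply, Finset.sum_eq_zero, smul_zero]
    intro i _
    rw [Measure.dirac_apply' _ measurableSet_Icc.compl, Set.indicator_of_notMem]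
    rw [Set.mem_compl_iff, not_not]
    have : x i ∈ M.charpoly.roots := by
      rw [hx]; exact Multiset.mem_map_of_mem x (Finset.mem_univ i)
    exact abs_le.1 (hB.abs_root_le this)
  · rw [he, integral_smul_measure, integral_finsetSum_measure]
    · simp [hk, div_eq_inv_mul]
    · intro i _
      exact integrable_dirac (by simp)

/-- The telescoping sum for `X ^ k - Y ^ k`, under the trace. The additional factor `Z` makes the
induction on `k` possible. -/
theorem abs_trace_pow_sub_pow_mul_le {X Y : Matrix ι ι ℝ} {β B : ℝ} (hB : 1 ≤ B)
    (hX : RowBdd X B) (hY : RowBdd Y B)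
    (h : ∀ W w, 0 ≤ w → RowBdd W w → |(W * (X - Y)).trace| ≤ β * w) (k : ℕ) :
    ∀ Z z, 0 ≤ z → RowBdd Z z → |((X ^ k - Y ^ k) * Z).trace| ≤ k * β * B ^ k * z := by
  have hB0 : 0 ≤ B := zero_le_one.trans hB
  have hβ : 0 ≤ β := by simpa using (abs_nonneg _).trans (h 1 1 zero_le_one RowBdd.one)
  induction k with
  | zero => intro Z z _ _; simp
  | succ k ih =>
    intro Z z hz hZ
    have e : (X ^ (k + 1) - Y ^ (k + 1)) * Z
        = X ^ k * (X - Y) * Z + (X ^ k - Y ^ k) * (Y * Z) := by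
      rw [pow_succ, pow_succ]; noncomm_ring
    rw [e, Matrix.trace_add, Matrix.trace_mul_comm, ← mul_assoc]
    have h1 := h (Z * X ^ k) (z * B ^ k) (by positivity) (hZ.mul (hX.pow hB0 k) (by positivity))
    have h2 := ih (Y * Z) (B * z) (by positivity) (hY.mul hZ hz)
    have h3 : β * (z * B ^ k) ≤ β * (z * B ^ (k + 1)) := by
      exact mul_le_mul_of_nonneg_left
        (mul_le_mul_of_nonneg_left (pow_le_pow_right₀ hB k.le_succ) hz) hβ
    calc _ ≤ _ := abs_add_le _ _
      _ ≤ β * (z * B ^ (k + 1)) + k * β * B ^ k * (B * z) := add_le_add (h1.trans h3) h2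
      _ = _ := by push_cast; ring

theorem abs_trace_pow_sub_le {X Y : Matrix ι ι ℝ} {β B : ℝ} (hB : 1 ≤ B)
    (hX : RowBdd X B) (hY : RowBdd Y B)
    (h : ∀ W w, 0 ≤ w → RowBdd W w → |(W * (X - Y)).trace| ≤ β * w) (k : ℕ) :
    |(X ^ k).trace - (Y ^ k).trace| ≤ k * β * B ^ k := by
  simpa using abs_trace_pow_sub_pow_mul_le hB hX hY h k 1 1 zero_le_one RowBdd.one

theorem abs_trace_mul_le (W Δ : Matrix ι ι ℝ) :
    |(W * Δ).trace| ≤ ∑ j, ∑ i, |W j i| * |Δ i j| := by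
  simp_rw [Matrix.trace, Matrix.diag_apply, Matrix.mul_apply]
  refine (Finset.abs_sum_le_sum_abs _ _).trans ?_
  gcongr with j
  exact (Finset.abs_sum_le_sum_abs _ _).trans_eq (by simp_rw [abs_mul])

/-- Suited to a perturbation `Δ` with few nonzero rows. -/
theorem abs_trace_mul_le_of_sum_le {Δ : Matrix ι ι ℝ} {β : ℝ} (h : ∑ i, ∑ j, |Δ i j| ≤ β)
    (W : Matrix ι ι ℝ) (w : ℝ) (hw : 0 ≤ w) (hW : RowBdd W w) : |(W * Δ).trace| ≤ β * w := calc
  |(W * Δ).trace| ≤ ∑ j, ∑ i, |W j i| * |Δ i j| := abs_trace_mul_le W Δ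
  _ ≤ ∑ j, ∑ i, w * |Δ i j| := by gcongr with j _ i _; exact hW.abs_le j i
  _ = (∑ i, ∑ j, |Δ i j|) * w := by
    rw [Finset.sum_comm, Finset.sum_mul]; simp_rw [Finset.sum_mul, mul_comm]
  _ ≤ β * w := by gcongr

/-- Suited to a perturbation `Δ` all of whose entries are of order `1 / n`. -/
theorem abs_trace_mul_le_of_abs_le [Nonempty ι] {Δ : Matrix ι ι ℝ} {C : ℝ}
    (h : ∀ i j, |Δ i j| ≤ C / Fintype.card ι)
    (W : Matrix ι ι ℝ) (w : ℝ) (_ : 0 ≤ w) (hW : RowBdd W w) : |(W * Δ).trace| ≤ C * w := calc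
  |(W * Δ).trace| ≤ ∑ j, ∑ i, |W j i| * |Δ i j| := abs_trace_mul_le W Δ
  _ ≤ ∑ j, ∑ i, |W j i| * (C / Fintype.card ι) := by gcongr with j _ i _; exact h i j
  _ ≤ ∑ j : ι, w * (C / Fintype.card ι) := by
    simp_rw [← Finset.sum_mul]
    have : 0 ≤ C / Fintype.card ι :=
      (abs_nonneg _).trans (h (Classical.arbitrary ι) (Classical.arbitrary ι))
    gcongr with j _
    exact hW j
  _ = C * w := by
    have : (Fintype.card ι : ℝ) ≠ 0 := by simp
    simp only [Finset.sum_const, Finset.card_univ, nsmul_eq_mul]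
    field_simp

end Spectrum

/-! ### The matrices attached to a graph -/

section Graph

variable {V : Type*} [Fintype V] [DecidableEq V] (c : ℝ≥0) (G : SimpleGraph V)

open Classical in
theorem adj_apply (i j : V) : adj G i j = if G.Adj i j then 1 else 0 := by
  simp [adj, SimpleGraph.adjMatrix_apply]

theorem adj_isSymm : (adj G).IsSymm := by
  ext i j
  by_cases h : G.Adj i j
  · simp [adj_apply, h, h.symm]
  · simp [adj_apply, h, mt SimpleGraph.Adj.symm h]

theorem sum_adj (i : V) : ∑ j, adj G i j = (G.neighborSet i).ncard := by
  classical
  simp only [adj_apply, Finset.sum_boole, Set.ncard_eq_toFinset_card']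
  congr 2
  ext j
  simp

open Classical in
theorem diagD_eq (i : V) : diagD c G i =
    if (G.neighborSet i).Nonempty then (c : ℝ) + (G.neighborSet i).ncard else 1 := by
  rw [diagD, sum_adj]
  have : (∀ j, adj G i j = 0) ↔ ¬ (G.neighborSet i).Nonempty := by
    simp only [adj_apply, ite_eq_right_iff, one_ne_zero, Set.Nonempty,
      SimpleGraph.mem_neighborSet, not_exists, imp_false]
  split_ifs <;> tauto

theorem one_le_diagD (i : V) : 1 ≤ diagD c G i := by
  rw [diagD_eq]
  split_ifs with h
  · have : 1 ≤ (G.neighborSet i).ncard := (Set.ncard_pos (Set.toFinite _)).2 h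
    have : (1 : ℝ) ≤ (G.neighborSet i).ncard := by exact_mod_cast this
    have := c.2
    linarith [NNReal.coe_nonneg c]
  · rfl

theorem diagD_pos (i : V) : 0 < diagD c G i := zero_lt_one.trans_le (one_le_diagD c G i)

theorem diagonal_inv_mul_apply {d : V → ℝ} (hd : ∀ i, 0 < d i) (A : Matrix V V ℝ) (i j : V) :
    ((Matrix.diagonal d)⁻¹ * A) i j = A i j / d i := by
  have : (Matrix.diagonal d)⁻¹ = Matrix.diagonal fun i => (d i)⁻¹ := by
    apply Matrix.inv_eq_left_inv
    rw [Matrix.diagonal_mul_diagonal, ← Matrix.diagonal_one]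
    congr 1
    ext i
    exact inv_mul_cancel₀ (hd i).ne'
  rw [this, Matrix.diagonal_mul, div_eq_inv_mul]

open Classical in
/-- No case distinction is needed for isolated vertices, whose rows vanish. -/
theorem matK_apply (i j : V) :
    matK c G i j = if G.Adj i j then 1 / ((c : ℝ) + (G.neighborSet i).ncard) else 0 := by
  rw [matK, diagonal_inv_mul_apply (diagD_pos c G), adj_apply, diagD_eq]
  split_ifs with h h'
  · rfl
  · exact absurd ⟨j, h⟩ h'
  · simp
  · simp

theorem matJ_isSymm : (matJ V).IsSymm := rfl

theorem rowSum_pos (hc : 0 < c) (i : V) : 0 < ∑ j, ((c : ℝ) • matJ V + adj G) i j := by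
  have : Nonempty V := ⟨i⟩
  refine Finset.sum_pos (fun j _ => ?_) Finset.univ_nonempty
  have h1 : (0 : ℝ) < c * (1 / Fintype.card V) := by positivity
  have h2 : 0 ≤ adj G i j := by rw [adj_apply]; split_ifs <;> simp
  simpa [matJ] using add_pos_of_pos_of_nonneg h1 h2

theorem rowSum_eq [Nonempty V] (i : V) :
    ∑ j, ((c : ℝ) • matJ V + adj G) i j = c + (G.neighborSet i).ncard := by
  have : (Fintype.card V : ℝ) ≠ 0 := by simp
  simp only [Matrix.add_apply, Finset.sum_add_distrib, sum_adj, Matrix.smul_apply, matJ,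
    Matrix.of_apply, Finset.sum_const, Finset.card_univ, nsmul_eq_mul, smul_eq_mul]
  field_simp

theorem symmetrizable_matK : Symmetrizable (matK c G) :=
  ⟨_, _, diagD_pos c G, adj_isSymm G, rfl⟩

theorem symmetrizable_matM' : Symmetrizable (matM' c G) :=
  ⟨_, _, diagD_pos c G, (matJ_isSymm.smul _).add (adj_isSymm G), rfl⟩

theorem symmetrizable_matM (hc : 0 < c) : Symmetrizable (matM c G) :=
  ⟨_, _, rowSum_pos c G hc, (matJ_isSymm.smul _).add (adj_isSymm G), rfl⟩

theorem rowBdd_matK : RowBdd (matK c G) 1 := fun i => by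
  have h : ∀ j, |matK c G i j| = adj G i j / (c + (G.neighborSet i).ncard) := fun j => by
    rw [matK_apply, adj_apply]
    split_ifs
    · exact abs_of_nonneg (by positivity)
    · simp
  simp_rw [h, ← Finset.sum_div, sum_adj]
  exact div_le_one_of_le₀ (by simp) (by positivity)

theorem abs_matM'_sub_matK_le (i j : V) :
    |(matM' c G - matK c G) i j| ≤ c / Fintype.card V := by
  rw [Matrix.sub_apply, matM', matK, diagonal_inv_mul_apply (diagD_pos c G),
    diagonal_inv_mul_apply (diagD_pos c G), Matrix.add_apply, ← sub_div, add_sub_cancel_right]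
  have : ((c : ℝ) • matJ V) i j = c / Fintype.card V := by simp [matJ, div_eq_mul_inv]
  rw [this, abs_of_nonneg (div_nonneg (by positivity) (diagD_pos c G i).le)]
  exact div_le_self (by positivity) (one_le_diagD c G i)

/-- The two matrices are normalized differently at isolated vertices, but there the row of `K`
vanishes. -/
theorem abs_matM_sub_matK_le (hc : 0 < c) (i j : V) :
    |(matM c G - matK c G) i j| ≤ 1 / Fintype.card V := by
  have : Nonempty V := ⟨i⟩
  have hJ : ((c : ℝ) • matJ V) i j = c / Fintype.card V := by simp [matJ, div_eq_mul_inv]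
  have hK : matK c G i j = adj G i j / (c + (G.neighborSet i).ncard) := by
    rw [matK_apply, adj_apply]; split_ifs <;> simp
  rw [Matrix.sub_apply, matM, rowNormalized, diagonal_inv_mul_apply (rowSum_pos c G hc), rowSum_eq,
    hK, Matrix.add_apply, ← sub_div, add_sub_cancel_right, hJ, abs_of_nonneg (by positivity),
    div_right_comm]
  gcongr
  exact div_le_one_of_le₀ (by simp) (by positivity)

theorem rowBdd_of_abs_sub_matK_le [Nonempty V] {X : Matrix V V ℝ} {C : ℝ}
    (h : ∀ i j, |(X - matK c G) i j| ≤ C / Fintype.card V) : RowBdd X (1 + C) := fun i => calc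
  ∑ j, |X i j| ≤ ∑ j, (|matK c G i j| + C / Fintype.card V) := by
    gcongr with j
    have := h i j
    rw [Matrix.sub_apply] at this
    have := abs_sub_abs_le_abs_sub (X i j) (matK c G i j)
    linarith
  _ ≤ 1 + C := by
    rw [Finset.sum_add_distrib]
    have h1 : (Fintype.card V : ℝ) ≠ 0 := by simp
    have h2 : ∑ _j : V, C / Fintype.card V = C := by
      simp only [Finset.sum_const, Finset.card_univ, nsmul_eq_mul]; field_simp
    rw [h2]
    have := rowBdd_matK c G i
    linarith

/-- Matrices which differ from `K` by entries of order `1 / n` have the same traces of powers, up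
to `O(1)`. -/
theorem abs_trace_pow_sub_matK_le [Nonempty V] {X : Matrix V V ℝ} {C : ℝ} (hC : 0 ≤ C)
    (h : ∀ i j, |(X - matK c G) i j| ≤ C / Fintype.card V) (k : ℕ) :
    |(X ^ k).trace - (matK c G ^ k).trace| ≤ k * C * (1 + C) ^ k :=
  abs_trace_pow_sub_le (by linarith) (rowBdd_of_abs_sub_matK_le c G h)
    ((rowBdd_matK c G).mono (by linarith)) (abs_trace_mul_le_of_abs_le h) k

variable {G} in
/-- Changing the status of one pair of vertices changes the trace of `K ^ k` by at most `4 k`,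
because only the two rows of `K` indexed by the pair are affected. -/
theorem abs_trace_matK_pow_sub_le {G' : SimpleGraph V} (u v : V)
    (h : ∀ i, i ≠ u → i ≠ v → G.neighborSet i = G'.neighborSet i) (k : ℕ) :
    |(matK c G ^ k).trace - (matK c G' ^ k).trace| ≤ 4 * k := by
  have key : ∑ i, ∑ j, |(matK c G - matK c G') i j| ≤ 4 := by
    have h0 : ∀ i, ∑ j, |(matK c G - matK c G') i j| ≤ 2 := fun i => calc
      _ ≤ ∑ j, (|matK c G i j| + |matK c G' i j|) := by
        gcongr with j; exact abs_sub _ _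
      _ ≤ 1 + 1 := by
        rw [Finset.sum_add_distrib]; exact add_le_add (rowBdd_matK c G i) (rowBdd_matK c G' i)
      _ = 2 := by norm_num
    have h1 : ∀ i ∉ ({u, v} : Finset V), ∑ j, |(matK c G - matK c G') i j| = 0 := fun i hi => by
      simp only [Finset.mem_insert, Finset.mem_singleton, not_or] at hi
      refine Finset.sum_eq_zero fun j _ => ?_
      have h2 := h i hi.1 hi.2
      have h3 : G.Adj i j ↔ G'.Adj i j := by
        rw [← SimpleGraph.mem_neighborSet, h2, SimpleGraph.mem_neighborSet]
      rw [Matrix.sub_apply, matK_apply, matK_apply, h2]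
      by_cases h4 : G.Adj i j
      · simp [h4, h3.1 h4]
      · simp [h4, mt h3.2 h4]
    rw [← Finset.sum_subset (Finset.subset_univ {u, v}) fun i _ hi => h1 i hi]
    calc _ ≤ ∑ i ∈ ({u, v} : Finset V), (2 : ℝ) := Finset.sum_le_sum fun i _ => h0 i
      _ ≤ 4 := by
        have : (({u, v} : Finset V).card : ℝ) ≤ 2 := by exact_mod_cast Finset.card_le_two
        simp only [Finset.sum_const, nsmul_eq_mul]
        linarith
  have := abs_trace_pow_sub_le le_rfl (rowBdd_matK c G) (rowBdd_matK c G')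
    (abs_trace_mul_le_of_sum_le key) k
  simpa [mul_comm] using this

end Graph

/-! ### The killed walk -/

section Walk

variable {V V' : Type*} {G : SimpleGraph V} {G' : SimpleGraph V'} {c : ℝ≥0}

open Classical in
theorem step_some_some {u : V} (hf : (G.neighborSet u).Finite) (w : V) :
    step G c (some u) (some w) =
      if G.Adj u w then 1 / ((c : ℝ≥0∞) + (G.neighborSet u).ncard) else 0 := by
  rw [step]
  split_ifs with h1 h2 h2
  · simp [stepWeight, h2]
  · simp [stepWeight, h2]
  · exact absurd ⟨hf, w, h2⟩ h1
  · simp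

theorem step_some_none {u : V} (hf : (G.neighborSet u).Finite) (hn : (G.neighborSet u).Nonempty) :
    step G c (some u) none = (c : ℝ≥0∞) / (c + (G.neighborSet u).ncard) := by
  simp [step, hf, hn, stepWeight]

theorem adj_of_step_ne_zero {u w : V} (h : step G c (some u) (some w) ≠ 0) : G.Adj u w := by
  rw [step] at h
  split_ifs at h with h1
  · by_contra h2
    simp [stepWeight, h2] at h
  · simp at h

theorem walkLaw_succ_ne_zero {v w : V} {k : ℕ} (h : walkLaw G c v (k + 1) (some w) ≠ 0) :
    ∃ u, walkLaw G c v k (some u) ≠ 0 ∧ G.Adj u w := by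
  rw [walkLaw, ← PMF.mem_support_iff, PMF.mem_support_bind_iff] at h
  obtain ⟨a, ha, h2⟩ := h
  rw [PMF.mem_support_iff] at ha h2
  cases a with
  | none => simp [step] at h2
  | some u => exact ⟨u, ha, adj_of_step_ne_zero h2⟩

theorem returnProb_nonneg (v : V) (k : ℕ) : 0 ≤ returnProb G v c k := ENNReal.toReal_nonneg

theorem returnProb_le_one (v : V) (k : ℕ) : returnProb G v c k ≤ 1 :=
  ENNReal.toReal_le_of_le_ofReal zero_le_one (by simpa using PMF.coe_le_one _ _)

/-- On a finite graph, the walk has transition matrix `K`. -/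
theorem toReal_walkLaw [Fintype V] [DecidableEq V] (v : V) (k : ℕ) (w : V) :
    (walkLaw G c v k (some w)).toReal = (matK c G ^ k) v w := by
  induction k generalizing w with
  | zero =>
    simp only [walkLaw, PMF.pure_apply, pow_zero, Matrix.one_apply, Option.some.injEq]
    split_ifs <;> simp_all
  | succ k ih =>
    rw [walkLaw, PMF.bind_apply, tsum_fintype, Fintype.sum_option, pow_succ, Matrix.mul_apply]
    have h0 : step G c none (some w) = 0 := by simp [step]
    rw [h0, mul_zero, zero_add, ENNReal.toReal_sum fun u _ =>
      ENNReal.mul_ne_top (PMF.apply_ne_top _ _) (PMF.apply_ne_top _ _)]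
    refine Finset.sum_congr rfl fun u _ => ?_
    rw [ENNReal.toReal_mul, ih, matK_apply, step_some_some (Set.toFinite _)]
    congr 1
    split_ifs with h
    · rw [ENNReal.toReal_div, ENNReal.toReal_add (by simp) (by simp)]
      simp
    · simp

theorem trace_matK_pow [Fintype V] [DecidableEq V] (k : ℕ) :
    (matK c G ^ k).trace = ∑ v, returnProb G v c k := by
  simp [Matrix.trace, returnProb, toReal_walkLaw]

/-- One step of the walk commutes with a map which is bijective on neighbourhoods. -/
theorem step_map (φ : V → V') {u : V} (hf : (G.neighborSet u).Finite)
    (hφ : Set.BijOn φ (G.neighborSet u) (G'.neighborSet (φ u))) :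
    (step G c (some u)).map (Option.map φ) = step G' c (some (φ u)) := by
  have hf' : (G'.neighborSet (φ u)).Finite := hφ.finite_iff_finite.1 hf
  have hc : (G'.neighborSet (φ u)).ncard = (G.neighborSet u).ncard := by
    rw [← hφ.image_eq, hφ.injOn.ncard_image]
  by_cases hn : (G.neighborSet u).Nonempty
  swap
  · have hn' : ¬ (G'.neighborSet (φ u)).Nonempty := by
      rw [← hφ.image_eq, Set.image_nonempty]; exact hn
    simp [step, hn, hn', PMF.pure_map]
  have hn' : (G'.neighborSet (φ u)).Nonempty := by
    rw [← hφ.image_eq]; exact hn.image φ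
  ext a
  rw [PMF.map_apply]
  cases a with
  | none =>
    rw [tsum_eq_single none]
    · simp [step_some_none hf hn, step_some_none hf' hn', hc]
    · rintro (_ | b) hb
      · simp at hb
      · simp
  | some w' =>
    by_cases hw : G'.Adj (φ u) w'
    · obtain ⟨w, hw1, rfl⟩ := hφ.surjOn hw
      rw [tsum_eq_single (some w)]
      · rw [Option.map_some, if_pos rfl, step_some_some hf, step_some_some hf', if_pos hw,
          if_pos (show G.Adj u w from hw1), hc]
      · rintro (_ | b) hb
        · simp
        · simp only [ite_eq_right_iff]
          intro h
          by_contra h2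
          have h3 := adj_of_step_ne_zero h2
          simp only [Option.map_some, Option.some.injEq] at h
          exact hb (by rw [hφ.injOn h3 hw1 h.symm])
    · rw [step_some_some hf', if_neg hw, ENNReal.tsum_eq_zero]
      rintro (_ | b)
      · simp
      · simp only [ite_eq_right_iff]
        intro h
        by_contra h2
        have h3 := hφ.mapsTo (adj_of_step_ne_zero h2)
        simp only [Option.map_some, Option.some.injEq] at h
        rw [← h] at h3
        exact hw h3

/-- A map which is bijective on neighbourhoods up to distance `h` from `v` transports the first
`h` steps of the walk. Here `ℓ` is any upper bound of the distance to `v`. -/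
theorem walkLaw_map (φ : V → V') (ℓ : V → ℕ) {v : V} {h : ℕ}
    (hf : ∀ u, (G.neighborSet u).Finite) (h0 : ℓ v = 0) (hℓ : ∀ u w, G.Adj u w → ℓ w ≤ ℓ u + 1)
    (hφ : ∀ u, ℓ u < h → Set.BijOn φ (G.neighborSet u) (G'.neighborSet (φ u))) (k : ℕ)
    (hk : k ≤ h) :
    (walkLaw G c v k).map (Option.map φ) = walkLaw G' c (φ v) k ∧
      ∀ u, walkLaw G c v k (some u) ≠ 0 → ℓ u ≤ k := by
  induction k with
  | zero =>
    refine ⟨by simp [walkLaw, PMF.pure_map], fun u hu => ?_⟩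
    have : u = v := by
      by_contra h
      simp [walkLaw, h] at hu
    simp [this, h0]
  | succ k ih =>
    obtain ⟨ih1, ih2⟩ := ih (by omega)
    constructor
    · rw [walkLaw, walkLaw, ← ih1, PMF.map_bind, PMF.bind_map]
      ext a
      rw [PMF.bind_apply, PMF.bind_apply]
      refine tsum_congr fun b => ?_
      by_cases hb : walkLaw G c v k b = 0
      · rw [hb, zero_mul, zero_mul]
      · congr 2
        cases b with
        | none => simp [step, PMF.pure_map]
        | some u =>
          have := ih2 u hb
          exact step_map φ (hf u) (hφ u (by omega))
    · intro w hw
      obtain ⟨u, hu, huw⟩ := walkLaw_succ_ne_zero hw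
      have := ih2 u hu
      have := hℓ u w huw
      omega

theorem returnProb_eq_of_local_iso (φ : V → V') (ℓ : V → ℕ) {v : V} {h : ℕ}
    (hf : ∀ u, (G.neighborSet u).Finite) (h0 : ℓ v = 0) (hℓ : ∀ u w, G.Adj u w → ℓ w ≤ ℓ u + 1)
    (hφ : ∀ u, ℓ u < h → Set.BijOn φ (G.neighborSet u) (G'.neighborSet (φ u)))
    (hinj : ∀ u, ℓ u ≤ h → φ u = φ v → u = v) {k : ℕ} (hk : k ≤ h) :
    returnProb G' (φ v) c k = returnProb G v c k := by
  obtain ⟨h1, h2⟩ := walkLaw_map (c := c) φ ℓ hf h0 hℓ hφ k hk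
  rw [returnProb, returnProb, ← h1, PMF.map_apply, tsum_eq_single (some v)]
  · simp
  · rintro (_ | u) hu
    · simp
    · simp only [ite_eq_right_iff]
      intro h
      by_contra h3
      simp only [Option.map_some, Option.some.injEq] at h
      exact hu (by rw [hinj u ((h2 u h3).trans hk) h.symm])

theorem returnProb_two_pos {v w : V} (hw : G.Adj v w) (hv : (G.neighborSet v).Finite)
    (hf : (G.neighborSet w).Finite) : 0 < returnProb G v c 2 := by
  refine ENNReal.toReal_pos ?_ (PMF.apply_ne_top _ _)
  have h1 : ∀ d : ℕ, 1 / ((c : ℝ≥0∞) + d) ≠ 0 := fun d => by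
    simp only [one_div, ne_eq, ENNReal.inv_eq_zero]; finiteness
  rw [← PMF.mem_support_iff, walkLaw, PMF.mem_support_bind_iff]
  refine ⟨some w, ?_, ?_⟩
  · rw [walkLaw, walkLaw, PMF.pure_bind, PMF.mem_support_iff, step_some_some hv, if_pos hw]
    exact h1 _
  · rw [PMF.mem_support_iff, step_some_some hf, if_pos hw.symm]
    exact h1 _

end Walk

/-! ### Truncation of trees -/

section Trunc

variable {ξ : List ℕ → ℕ} {c : ℝ≥0}

theorem length_le_of_gwTree_adj (u w : {v : List ℕ // IsIndividual ξ v}) (h : (gwTree ξ).Adj u w) :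
    w.1.length ≤ u.1.length + 1 := by
  rcases h with ⟨i, h⟩ | ⟨i, h⟩
  · simp [h]
  · simp only [h, List.length_cons]
    omega

/-- Trees are bipartite. -/
theorem gwReturnProb_odd {k : ℕ} (hk : Odd k) : gwReturnProb c k ξ = 0 := by
  have key : ∀ (k : ℕ) (u : {v : List ℕ // IsIndividual ξ v}),
      walkLaw (gwTree ξ) c (gwRoot ξ) k (some u) ≠ 0 → (Even u.1.length ↔ Even k) := by
    intro k
    induction k with
    | zero =>
      intro u hu
      have : u = gwRoot ξ := by
        by_contra h
        simp [walkLaw, h] at hu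
      simp [this, gwRoot]
    | succ k ih =>
      intro w hw
      obtain ⟨u, hu, huw⟩ := walkLaw_succ_ne_zero hw
      have h1 := ih u hu
      rcases huw with ⟨i, h⟩ | ⟨i, h⟩
      · rw [h, List.length_cons, Nat.even_add_one, Nat.even_add_one, h1]
      · rw [h, List.length_cons, Nat.even_add_one] at h1
        rw [Nat.even_add_one, ← h1, not_not]
  rw [gwReturnProb, returnProb]
  by_contra h
  have := key k (gwRoot ξ) (fun h2 => h (by rw [h2]; rfl))
  simp only [gwRoot, List.length_nil, Even.zero, true_iff] at this
  exact Nat.not_even_iff_odd.2 hk this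

theorem gwReturnProb_two_pos (h : ξ [] ≠ 0) : 0 < gwReturnProb c 2 ξ := by
  have h1 : IsIndividual ξ [0] := ⟨trivial, Nat.pos_of_ne_zero h⟩
  exact returnProb_two_pos (w := ⟨[0], h1⟩) (Or.inl ⟨0, rfl⟩) (gwTree_neighborSet_finite _ _)
    (gwTree_neighborSet_finite _ _)

open Classical in
/-- The offspring numbers of the tree with offspring numbers `ξ` truncated at height `h`: the
individuals of generation `h` become childless, and the numbers `ξ u` for lists `u` which are not
individuals are normalized to `0`. -/
noncomputable def trunc (h : ℕ) (ξ : List ℕ → ℕ) (u : List ℕ) : ℕ :=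
  if IsIndividual ξ u ∧ u.length < h then ξ u else 0

theorem isIndividual_trunc {h : ℕ} {u : List ℕ} :
    IsIndividual (trunc h ξ) u ↔ IsIndividual ξ u ∧ u.length ≤ h := by
  induction u with
  | nil => simp [IsIndividual]
  | cons i u ih =>
    simp only [IsIndividual, ih, trunc, List.length_cons]
    split_ifs with h1
    · constructor
      · rintro ⟨⟨h2, h3⟩, h4⟩
        exact ⟨⟨h2, h4⟩, by omega⟩
      · rintro ⟨⟨h2, h3⟩, h4⟩
        exact ⟨⟨h2, by omega⟩, h3⟩
    · simp only [not_lt_zero, and_false, false_iff]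
      rintro ⟨⟨h2, h3⟩, h4⟩
      exact h1 ⟨h2, by omega⟩

theorem trunc_trunc (h : ℕ) (ξ : List ℕ → ℕ) : trunc h (trunc h ξ) = trunc h ξ := by
  ext u
  by_cases h1 : IsIndividual ξ u ∧ u.length < h
  · rw [trunc, if_pos ⟨isIndividual_trunc.2 ⟨h1.1, h1.2.le⟩, h1.2⟩]
  · rw [trunc, isIndividual_trunc, if_neg (by tauto), trunc, if_neg h1]

theorem finite_isIndividual_length_le (ξ : List ℕ → ℕ) (h : ℕ) :
    {u : List ℕ | IsIndividual ξ u ∧ u.length ≤ h}.Finite := by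
  induction h with
  | zero =>
    refine (Set.finite_singleton []).subset ?_
    rintro u ⟨-, hu⟩
    simpa using hu
  | succ h ih =>
    refine ((Set.finite_singleton []).union
      (ih.biUnion fun u _ => (Set.finite_Iio (ξ u)).image (fun i => i :: u))).subset ?_
    rintro (_ | ⟨i, u⟩) ⟨h1, h2⟩
    · simp
    · right
      simp only [Set.mem_iUnion]
      exact ⟨u, ⟨h1.1, by simpa using h2⟩, i, h1.2, rfl⟩

/-- The walk does not see beyond height `h` during its first `h` steps. -/
theorem gwReturnProb_trunc {h k : ℕ} (hk : k ≤ h) :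
    gwReturnProb c k (trunc h ξ) = gwReturnProb c k ξ := by
  let φ : {v : List ℕ // IsIndividual (trunc h ξ) v} → {v : List ℕ // IsIndividual ξ v} :=
    fun u => ⟨u.1, (isIndividual_trunc.1 u.2).1⟩
  have hφ : Function.Injective φ := fun u w e =>
    Subtype.ext (congrArg Subtype.val e :)
  refine (returnProb_eq_of_local_iso (v := gwRoot (trunc h ξ)) φ (fun u => u.1.length)
    (fun u => gwTree_neighborSet_finite _ _) rfl length_le_of_gwTree_adj (fun u hu => ?_)
    (fun u _ e => hφ e) hk).symm
  refine ⟨fun w hw => hw, hφ.injOn, fun w hw => ?_⟩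
  have h1 := length_le_of_gwTree_adj _ _ hw
  exact ⟨⟨w.1, isIndividual_trunc.2 ⟨w.2, h1.trans hu⟩⟩, hw, rfl⟩

end Trunc

/-! ### The law of the truncated Galton–Watson tree -/

section GaltonWatson

/-- The individuals of height less than `h` of the tree with offspring numbers `t`. -/
noncomputable def internal (h : ℕ) (t : List ℕ → ℕ) : Finset (List ℕ) :=
  Set.Finite.toFinset (s := {u | IsIndividual t u ∧ u.length < h})
    ((finite_isIndividual_length_le t h).subset fun _ hu => ⟨hu.1, hu.2.le⟩)

theorem mem_internal {h : ℕ} {t : List ℕ → ℕ} {u : List ℕ} :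
    u ∈ internal h t ↔ IsIndividual t u ∧ u.length < h := by simp [internal]

/-- The truncation of a tree depends only on the offspring numbers of its own individuals of height
less than `h`. -/
theorem trunc_congr {h : ℕ} {t ξ : List ℕ → ℕ} (hξ : ∀ u ∈ internal h t, ξ u = t u) :
    trunc h ξ = trunc h t := by
  have key : ∀ u : List ℕ, u.length ≤ h → (IsIndividual ξ u ↔ IsIndividual t u) := by
    intro u
    induction u with
    | nil => intro _; simp [IsIndividual]
    | cons i u ih =>
      intro hu
      rw [List.length_cons] at hu
      simp only [IsIndividual, ih (by omega)]
      refine and_congr_right fun h1 => ?_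
      rw [hξ u (mem_internal.2 ⟨h1, by omega⟩)]
  ext u
  by_cases hu : u.length < h
  · by_cases h1 : IsIndividual t u
    · rw [trunc, trunc, if_pos ⟨(key u hu.le).2 h1, hu⟩, if_pos ⟨h1, hu⟩]
      exact hξ u (mem_internal.2 ⟨h1, hu⟩)
    · rw [trunc, trunc, if_neg fun h2 => h1 ((key u hu.le).1 h2.1), if_neg fun h2 => h1 h2.1]
  · simp [trunc, hu]

theorem support_trunc_finite (h : ℕ) (ξ : List ℕ → ℕ) : (Function.support (trunc h ξ)).Finite := by
  refine (internal h ξ).finite_toSet.subset fun u hu => ?_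
  rw [Finset.mem_coe, mem_internal]
  by_contra h1
  exact hu (if_neg h1)

/-- The truncation of a tree at height `h`, as an element of a countable type. -/
noncomputable def truncFinsupp (h : ℕ) (ξ : List ℕ → ℕ) : List ℕ →₀ ℕ :=
  Finsupp.ofSupportFinite (trunc h ξ) (support_trunc_finite h ξ)

@[simp]
theorem coe_truncFinsupp (h : ℕ) (ξ : List ℕ → ℕ) : ⇑(truncFinsupp h ξ) = trunc h ξ := rfl

theorem truncFinsupp_preimage {h : ℕ} {t : List ℕ →₀ ℕ} (ht : trunc h t = t) :
    truncFinsupp h ⁻¹' {t} = Set.pi (internal h t) fun u => {t u} := by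
  ext ξ
  simp only [Set.mem_preimage, Set.mem_singleton_iff, Set.mem_pi, Finset.mem_coe]
  rw [← DFunLike.coe_fn_eq, coe_truncFinsupp]
  constructor
  · intro h1 u hu
    rw [mem_internal, ← h1, isIndividual_trunc] at hu
    rw [← h1, trunc, if_pos ⟨hu.1.1, hu.2⟩]
  · intro h1
    rw [trunc_congr h1, ht]

theorem truncFinsupp_preimage_eq_empty {h : ℕ} {t : List ℕ →₀ ℕ} (ht : trunc h t ≠ t) :
    truncFinsupp h ⁻¹' {t} = ∅ := by
  ext ξ
  simp only [Set.mem_preimage, Set.mem_singleton_iff, Set.mem_empty_iff_false, iff_false]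
  rintro rfl
  exact ht (trunc_trunc h ξ)

theorem measurableSet_truncFinsupp_preimage (h : ℕ) (t : List ℕ →₀ ℕ) :
    MeasurableSet (truncFinsupp h ⁻¹' {t}) := by
  by_cases ht : trunc h t = t
  · rw [truncFinsupp_preimage ht]
    exact MeasurableSet.pi (Finset.countable_toSet _) fun _ _ => measurableSet_singleton _
  · rw [truncFinsupp_preimage_eq_empty ht]
    exact MeasurableSet.empty

/-- The discrete structure, natural on this countable type. -/
local instance : MeasurableSpace (List ℕ →₀ ℕ) := ⊤

local instance : MeasurableSingletonClass (List ℕ →₀ ℕ) := ⟨fun _ => trivial⟩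

theorem measurable_truncFinsupp (h : ℕ) : Measurable (truncFinsupp h) :=
  measurable_to_countable' (measurableSet_truncFinsupp_preimage h)

instance (p : ℝ≥0) : IsProbabilityMeasure (offspringLaw p) := by
  unfold offspringLaw; infer_instance

/-- The probability that the Galton–Watson tree, truncated at height `h`, is `t`. -/
noncomputable def gwProb (p : ℝ≥0) (h : ℕ) (t : List ℕ →₀ ℕ) : ℝ :=
  (offspringLaw p).real (truncFinsupp h ⁻¹' {t})

theorem gwProb_eq_prod (p : ℝ≥0) {h : ℕ} {t : List ℕ →₀ ℕ} (ht : trunc h t = t) :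
    gwProb p h t = ∏ u ∈ internal h t, (Real.exp (-p) * p ^ t u / (t u).factorial) := by
  rw [gwProb, truncFinsupp_preimage ht, offspringLaw, measureReal_def,
    Measure.infinitePi_pi _ fun _ _ => measurableSet_singleton _, ENNReal.toReal_prod]
  refine Finset.prod_congr rfl fun u _ => ?_
  rw [← measureReal_def, poissonMeasure_real_singleton]

theorem gwProb_eq_zero (p : ℝ≥0) {h : ℕ} {t : List ℕ →₀ ℕ} (ht : trunc h t ≠ t) :
    gwProb p h t = 0 := by
  simp [gwProb, truncFinsupp_preimage_eq_empty ht]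

/-- The expectation of a functional of the truncated tree is a sum over a countable set of trees. -/
theorem integrable_and_hasSum_trunc (p : ℝ≥0) (h : ℕ) {f : (List ℕ → ℕ) → ℝ}
    (hf0 : ∀ ξ, 0 ≤ f ξ) (hf1 : ∀ ξ, f ξ ≤ 1) (hf : ∀ ξ, f (trunc h ξ) = f ξ) :
    Integrable f (offspringLaw p) ∧
      HasSum (fun t : List ℕ →₀ ℕ => gwProb p h t * f t) (∫ ξ, f ξ ∂(offspringLaw p)) := by
  set ν := (offspringLaw p).map (truncFinsupp h)
  have hν : IsProbabilityMeasure ν :=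
    Measure.isProbabilityMeasure_map (measurable_truncFinsupp h).aemeasurable
  have hreal : ∀ t, ν.real {t} = gwProb p h t := fun t =>
    map_measureReal_apply (measurable_truncFinsupp h) (measurableSet_singleton t)
  have hfun : f = (fun t : List ℕ →₀ ℕ => f t) ∘ truncFinsupp h := by
    ext ξ; exact (hf ξ).symm
  have hm : Measurable fun t : List ℕ →₀ ℕ => f t := fun _ _ => trivial
  have hi : ∀ {g : (List ℕ →₀ ℕ) → ℝ}, (∀ t, 0 ≤ g t) → (∀ t, g t ≤ 1) → Integrable g ν :=
    fun {g} h0 h1 => Integrable.of_bound (measurable_of_countable g).aestronglyMeasurable 1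
      (Eventually.of_forall fun t => by rw [Real.norm_of_nonneg (h0 t)]; exact h1 t)
  have hint := hi (fun t => hf0 t) fun t => hf1 t
  have hone : HasSum (gwProb p h) 1 := by
    have h1 := integral_countable (hi (g := fun _ => 1) (fun _ => zero_le_one) fun _ => le_rfl)
    simp only [integral_const, probReal_univ, smul_eq_mul, mul_one, hreal] at h1
    rw [h1]
    refine Summable.hasSum ?_
    by_contra h2
    exact one_ne_zero (h1.trans (tsum_eq_zero_of_not_summable h2))
  constructor
  · rw [hfun]
    exact hint.comp_measurable (measurable_truncFinsupp h)
  · have h1 : ∫ ξ, f ξ ∂(offspringLaw p) = ∫ t, f t ∂ν := by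
      rw [integral_map (measurable_truncFinsupp h).aemeasurable hm.aestronglyMeasurable]
      exact integral_congr_ae (Eventually.of_forall fun ξ => (hf ξ).symm)
    rw [h1, integral_countable hint]
    simp only [hreal, smul_eq_mul]
    have h0 : ∀ t, 0 ≤ gwProb p h t := fun t => measureReal_nonneg
    exact (Summable.of_nonneg_of_le (fun t => mul_nonneg (h0 t) (hf0 t))
      (fun t => mul_le_of_le_one_right (h0 t) (hf1 t)) hone.summable).hasSum

theorem gwReturnProb_nonneg (c : ℝ≥0) (k : ℕ) (ξ : List ℕ → ℕ) : 0 ≤ gwReturnProb c k ξ :=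
  returnProb_nonneg _ _

theorem gwReturnProb_le_one (c : ℝ≥0) (k : ℕ) (ξ : List ℕ → ℕ) : gwReturnProb c k ξ ≤ 1 :=
  returnProb_le_one _ _

theorem integrable_gwReturnProb (p c : ℝ≥0) (k : ℕ) :
    Integrable (gwReturnProb c k) (offspringLaw p) :=
  (integrable_and_hasSum_trunc p k (gwReturnProb_nonneg c k) (gwReturnProb_le_one c k)
    fun _ => gwReturnProb_trunc le_rfl).1

/-- `𝔼 r_k(T, ∅, c)`. -/
noncomputable def gwMoment (p c : ℝ≥0) (k : ℕ) : ℝ := ∫ ξ, gwReturnProb c k ξ ∂(offspringLaw p)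

theorem gwMoment_odd (p c : ℝ≥0) {k : ℕ} (hk : Odd k) : gwMoment p c k = 0 := by
  simp [gwMoment, gwReturnProb_odd hk]

theorem gwMoment_two_pos {p : ℝ≥0} (hp : 0 < p) (c : ℝ≥0) : 0 < gwMoment p c 2 := by
  refine (integral_nonneg (gwReturnProb_nonneg c 2)).lt_of_ne fun h => ?_
  rw [eq_comm, integral_eq_zero_iff_of_nonneg (gwReturnProb_nonneg c 2)
    (integrable_gwReturnProb p c 2)] at h
  -- the root has exactly one child with positive probability
  have h1 : offspringLaw p (Set.pi ({[]} : Finset (List ℕ)) fun _ => {1}) = 0 := by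
    refine measure_mono_null (fun ξ hξ => ?_) h
    have : ξ [] = 1 := by simpa using hξ
    exact (gwReturnProb_two_pos (by omega)).ne'
  rw [offspringLaw, Measure.infinitePi_pi _ fun _ _ => measurableSet_singleton _,
    Finset.prod_singleton] at h1
  have h2 := poissonMeasure_real_singleton_pos 1 hp
  rw [measureReal_def, h1] at h2
  exact lt_irrefl _ h2

end GaltonWatson

/-! ### Functions of independent Bernoulli variables -/

section Bernoulli

variable {α : Type*} [DecidableEq α]

/-- The expectation of `f S`, where `S` is a random subset of `s` which contains every element
with probability `q`, independently. -/
def bernExp (q : ℝ) (s : Finset α) (f : Finset α → ℝ) : ℝ :=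
  ∑ S ∈ s.powerset, q ^ S.card * (1 - q) ^ (s.card - S.card) * f S

theorem bernExp_insert (q : ℝ) {s : Finset α} {a : α} (ha : a ∉ s) (f : Finset α → ℝ) :
    bernExp q (insert a s) f =
      (1 - q) * bernExp q s f + q * bernExp q s (fun S => f (insert a S)) := by
  simp only [bernExp]
  rw [Finset.sum_powerset_insert ha, Finset.card_insert_of_notMem ha, Finset.mul_sum,
    Finset.mul_sum]
  congr 1
  · refine Finset.sum_congr rfl fun S hS => ?_
    have := Finset.card_le_card (Finset.mem_powerset.1 hS)
    rw [Nat.succ_sub this, pow_succ]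
    ring
  · refine Finset.sum_congr rfl fun S hS => ?_
    rw [Finset.card_insert_of_notMem fun h => ha (Finset.mem_powerset.1 hS h),
      Nat.add_sub_add_right, pow_succ]
    ring

theorem abs_bernExp_sub_le {q : ℝ} (h0 : 0 ≤ q) (h1 : q ≤ 1) {L : ℝ} (s : Finset α) :
    ∀ f g : Finset α → ℝ, (∀ S ⊆ s, |f S - g S| ≤ L) → |bernExp q s f - bernExp q s g| ≤ L := by
  induction s using Finset.induction_on with
  | empty =>
    intro f g h
    simpa [bernExp] using h ∅ subset_rfl
  | insert a s ha ih =>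
    intro f g hg
    have i1 := ih f g fun S hS => hg S (hS.trans (Finset.subset_insert a s))
    have i2 := ih (fun S => f (insert a S)) (fun S => g (insert a S)) fun S hS =>
      hg _ (Finset.insert_subset_insert a hS)
    rw [bernExp_insert q ha, bernExp_insert q ha]
    rw [abs_le] at i1 i2 ⊢
    constructor <;> nlinarith

/-- The Efron–Stein inequality: a function which varies by at most `L` when one of the Bernoulli
variables is changed has variance at most `|s| q (1 - q) L²`. -/
theorem bernExp_variance_le {q : ℝ} (h0 : 0 ≤ q) (h1 : q ≤ 1) {L : ℝ} (s : Finset α) :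
    ∀ f : Finset α → ℝ, (∀ a ∈ s, ∀ S ⊆ s, |f (insert a S) - f S| ≤ L) →
      bernExp q s (fun S => f S ^ 2) - bernExp q s f ^ 2 ≤ s.card * (q * (1 - q)) * L ^ 2 := by
  have h1' : 0 ≤ 1 - q := by linarith
  induction s using Finset.induction_on with
  | empty =>
    intro f _
    simp [bernExp]
  | insert a s ha ih =>
    intro f hf
    have i1 := ih f fun b hb S hS => hf b (Finset.mem_insert_of_mem hb) S
      (hS.trans (Finset.subset_insert a s))
    have i2 := ih (fun S => f (insert a S)) fun b hb S hS => by
      rw [Finset.insert_comm]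
      exact hf b (Finset.mem_insert_of_mem hb) _ (Finset.insert_subset_insert a hS)
    have i3 := abs_bernExp_sub_le h0 h1 s (fun S => f (insert a S)) f fun S hS =>
      hf a (Finset.mem_insert_self a s) S (hS.trans (Finset.subset_insert a s))
    have i4 := sq_le_sq' (abs_le.1 i3).1 (abs_le.1 i3).2
    rw [bernExp_insert q ha, bernExp_insert q ha, Finset.card_insert_of_notMem ha]
    push_cast
    -- the variance is the mean of the two conditional variances plus `q (1 - q)` times the squared
    -- difference of the two conditional means
    have i5 := mul_le_mul_of_nonneg_left i4 (mul_nonneg h0 h1')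
    have i6 := mul_le_mul_of_nonneg_left i1 h1'
    have i7 := mul_le_mul_of_nonneg_left i2 h0
    linarith

/-- A lower bound for the probability that a random subset of `s` contains `E₁` and avoids `E₀`, with
equality if `E₀ ⊆ s`. -/
theorem le_bernExp_indicator {q : ℝ} (h0 : 0 ≤ q) (h1 : q ≤ 1) (s : Finset α) :
    ∀ E₁ E₀ : Finset α, E₁ ⊆ s → Disjoint E₁ E₀ →
      q ^ E₁.card * (1 - q) ^ E₀.card ≤
        bernExp q s (fun S => if E₁ ⊆ S ∧ Disjoint E₀ S then 1 else 0) := by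
  have h1' : 0 ≤ 1 - q := by linarith
  have hnn : ∀ (s : Finset α) (f : Finset α → ℝ), (∀ S, 0 ≤ f S) → 0 ≤ bernExp q s f :=
    fun s f hf => Finset.sum_nonneg fun S _ => mul_nonneg (by positivity) (hf S)
  have hcg : ∀ (s : Finset α) (f g : Finset α → ℝ), (∀ S ⊆ s, f S = g S) →
      bernExp q s f = bernExp q s g := fun s f g hfg =>
    Finset.sum_congr rfl fun S hS => by rw [hfg S (Finset.mem_powerset.1 hS)]
  induction s using Finset.induction_on with
  | empty =>
    intro E₁ E₀ h2 _
    rw [Finset.subset_empty.1 h2]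
    simpa [bernExp] using pow_le_one₀ h1' (by linarith)
  | insert a s ha ih =>
    intro E₁ E₀ h2 h3
    rw [bernExp_insert q ha]
    by_cases h4 : a ∈ E₁
    · have i1 := ih (E₁.erase a) E₀ (by rwa [← Finset.subset_insert_iff])
        (h3.mono_left (Finset.erase_subset _ _))
      have i2 : a ∉ E₀ := Finset.disjoint_left.1 h3 h4
      rw [hcg s (fun S => if E₁ ⊆ insert a S ∧ Disjoint E₀ (insert a S) then 1 else 0)
        (fun S => if E₁.erase a ⊆ S ∧ Disjoint E₀ S then 1 else 0) fun S _ => by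
          simp only [Finset.subset_insert_iff, Finset.disjoint_insert_right, i2, not_false_eq_true,
            true_and]]
      have i3 : 0 ≤ bernExp q s (fun S => if E₁ ⊆ S ∧ Disjoint E₀ S then 1 else 0) :=
        hnn _ _ fun S => by positivity
      rw [← Finset.card_erase_add_one h4, pow_succ]
      nlinarith [mul_le_mul_of_nonneg_left i1 h0, mul_nonneg h1' i3]
    · have h2' : E₁ ⊆ s := (Finset.subset_insert_iff_of_notMem h4).1 h2
      have i1 := ih E₁ (E₀.erase a) h2' (h3.mono_right (Finset.erase_subset _ _))
      rw [hcg s (fun S => if E₁ ⊆ S ∧ Disjoint E₀ S then 1 else 0)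
        (fun S => if E₁ ⊆ S ∧ Disjoint (E₀.erase a) S then 1 else 0) fun S hS => by
          refine if_congr (and_congr_right fun _ => ?_) rfl rfl
          rw [Finset.disjoint_erase_comm, Finset.erase_eq_of_notMem fun h => ha (hS h)]]
      by_cases h5 : a ∈ E₀
      · have i3 : 0 ≤ bernExp q s
            (fun S => if E₁ ⊆ insert a S ∧ Disjoint E₀ (insert a S) then 1 else 0) :=
          hnn _ _ fun S => by positivity
        rw [← Finset.card_erase_add_one h5, pow_succ]
        nlinarith [mul_le_mul_of_nonneg_left i1 h1', mul_nonneg h0 i3]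
      · rw [Finset.erase_eq_of_notMem h5] at i1 ⊢
        have i2 : (fun S : Finset α =>
            if E₁ ⊆ insert a S ∧ Disjoint E₀ (insert a S) then (1 : ℝ) else 0) =
            fun S => if E₁ ⊆ S ∧ Disjoint E₀ S then 1 else 0 := by
          ext S
          refine if_congr ?_ rfl rfl
          rw [Finset.subset_insert_iff_of_notMem h4, Finset.disjoint_insert_right]
          simp only [h5, not_false_eq_true, true_and]
        rw [i2]
        linarith

end Bernoulli

/-! ### The binomial random graph -/

section BinomialRandom

variable {V : Type*} [Fintype V] [DecidableEq V] (q : unitInterval)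

instance : MeasurableSingletonClass (SimpleGraph V) where
  measurableSet_singleton H := by
    convert SimpleGraph.measurable_edgeSet (measurableSet_singleton H.edgeSet)
    ext H'
    simp

open Classical in
theorem integral_binomialRandom (f : SimpleGraph V → ℝ) :
    ∫ H, f H ∂(SimpleGraph.binomialRandom V q) =
      bernExp q (Finset.univ.filter fun e : Sym2 V => ¬ e.IsDiag)
        fun S => f (SimpleGraph.fromEdgeSet (S : Set (Sym2 V))) := by
  have hcard : (Finset.univ.filter fun e : Sym2 V => ¬ e.IsDiag).card
      = (Nat.card V).choose 2 := by
    rw [Nat.card_eq_fintype_card, ← Sym2.card_subtype_not_diag, Fintype.card_subtype]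
  rw [integral_fintype Integrable.of_finite, bernExp, hcard]
  refine Finset.sum_nbij' (fun H => H.edgeFinset)
    (fun S => SimpleGraph.fromEdgeSet (S : Set (Sym2 V))) ?_ ?_ ?_ ?_ ?_
  · intro H _
    rw [Finset.mem_powerset]
    intro e he
    rw [SimpleGraph.mem_edgeFinset] at he
    simpa using H.not_isDiag_of_mem_edgeSet he
  · intro S _
    exact Finset.mem_univ _
  · intro H _
    simp
  · intro S hS
    ext e
    simp only [SimpleGraph.mem_edgeFinset, SimpleGraph.edgeSet_fromEdgeSet]
    simp only [Set.mem_sdiff, Finset.mem_coe, Sym2.mem_diagSet, and_iff_left_iff_imp]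
    intro he
    simpa using Finset.mem_powerset.1 hS he
  · intro H _
    rw [measureReal_def, SimpleGraph.binomialRandom_singleton, SimpleGraph.coe_edgeFinset,
      SimpleGraph.fromEdgeSet_edgeSet, smul_eq_mul]
    congr 1
    rw [Set.ncard_eq_toFinset_card', ← SimpleGraph.edgeFinset]
    simp

/-- A variance bound for functions of the random graph which vary by at most `L` when only the
neighbourhoods of two vertices change; this covers a change of the status of one pair. -/
theorem integral_sq_sub_le_binomialRandom (f : SimpleGraph V → ℝ) {L : ℝ}
    (hf : ∀ (H H' : SimpleGraph V) (u v : V),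
      (∀ i, i ≠ u → i ≠ v → H.neighborSet i = H'.neighborSet i) → |f H - f H'| ≤ L) :
    ∫ H, (f H - ∫ H', f H' ∂(SimpleGraph.binomialRandom V q)) ^ 2
      ∂(SimpleGraph.binomialRandom V q) ≤ (Fintype.card V : ℝ) ^ 2 * q * L ^ 2 := by
  set m := ∫ H', f H' ∂(SimpleGraph.binomialRandom V q)
  have e : ∫ H, (f H - m) ^ 2 ∂(SimpleGraph.binomialRandom V q) =
      ∫ H, f H ^ 2 ∂(SimpleGraph.binomialRandom V q) - m ^ 2 := by
    have : ∀ H, (f H - m) ^ 2 = f H ^ 2 - 2 * m * f H + m ^ 2 := fun H => by ring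
    simp_rw [this]
    rw [integral_add Integrable.of_finite Integrable.of_finite,
      integral_sub Integrable.of_finite Integrable.of_finite, integral_const_mul]
    simp only [integral_const, probReal_univ, smul_eq_mul]
    ring
  have hq0 : (0 : ℝ) ≤ q := q.2.1
  have hq1 : (q : ℝ) ≤ 1 := q.2.2
  classical
  rw [e]
  simp only [m]
  rw [integral_binomialRandom, integral_binomialRandom]
  refine (bernExp_variance_le hq0 hq1 (L := L) _ _ ?_).trans ?_
  · rintro ⟨u, v⟩ - S -
    refine hf _ _ u v fun i hu hv => ?_
    ext j
    simp only [SimpleGraph.mem_neighborSet, SimpleGraph.fromEdgeSet_adj, Finset.coe_insert,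
      Set.mem_insert_iff]
    have : s(i, j) ≠ s(u, v) := by
      intro h
      rcases Sym2.eq_iff.1 h with h | h
      · exact hu h.1
      · exact hv h.1
    tauto
  · have hcard : ((Finset.univ.filter fun e : Sym2 V => ¬ e.IsDiag).card : ℝ)
        ≤ (Fintype.card V : ℝ) ^ 2 := by
      rw [← Fintype.card_subtype, Sym2.card_subtype_not_diag]
      exact_mod_cast Nat.choose_le_pow _ 2
    have : (q : ℝ) * (1 - q) ≤ q := by nlinarith
    have : 0 ≤ (q : ℝ) * (1 - q) := mul_nonneg hq0 (by linarith)
    gcongr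

/-- The pairs in `E₁` are edges and those in `E₀` are not with probability at least
`q ^ |E₁| (1 - q) ^ |E₀|`; the bound is not sharp if `E₀` has diagonal elements. -/
theorem le_binomialRandom_real {E₁ E₀ : Finset (Sym2 V)} (h1 : ∀ e ∈ E₁, ¬ e.IsDiag)
    (h2 : Disjoint E₁ E₀) :
    (q : ℝ) ^ E₁.card * (1 - q) ^ E₀.card ≤ (SimpleGraph.binomialRandom V q).real
      {H | (∀ e ∈ E₁, e ∈ H.edgeSet) ∧ ∀ e ∈ E₀, e ∉ H.edgeSet} := by
  classical
  refine (le_bernExp_indicator (q := q) q.2.1 q.2.2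
    (Finset.univ.filter fun e : Sym2 V => ¬ e.IsDiag) E₁ E₀ (fun e he => by simpa using h1 e he)
    h2).trans_eq ?_
  have := integral_binomialRandom q (Set.indicator
      {H : SimpleGraph V | (∀ e ∈ E₁, e ∈ H.edgeSet) ∧ ∀ e ∈ E₀, e ∉ H.edgeSet} 1)
  rw [integral_indicator_one (Set.toFinite _).measurableSet] at this
  rw [this]
  refine Finset.sum_congr rfl fun S hS => ?_
  congr 1
  simp only [Set.indicator_apply]
  refine if_congr ?_ rfl rfl
  have h3 : ∀ e, e ∈ (SimpleGraph.fromEdgeSet (S : Set (Sym2 V))).edgeSet ↔ e ∈ S := fun e => by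
    rw [SimpleGraph.edgeSet_fromEdgeSet]
    simp only [Set.mem_sdiff, Finset.mem_coe, Sym2.mem_diagSet, and_iff_left_iff_imp]
    intro he
    simpa using Finset.mem_powerset.1 hS he
  simp only [Set.mem_ofPred_eq, h3, Finset.disjoint_left]
  rfl

end BinomialRandom

/-! ### Embedded trees in a random graph -/

section Exploration

variable {V : Type*} [Fintype V] [LinearOrder V]

/-- Families of disjoint sets of prescribed cardinalities `d u`, `u ∈ I`, which avoid `F`: a lower
bound for their number. -/
theorem exists_disjoint_families {α : Type*} [DecidableEq α] (F : Finset V) (d : α → ℕ) (m : ℕ)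
    (I : Finset α) (hm : m + F.card + ∑ u ∈ I, d u ≤ Fintype.card V) :
    ∃ 𝒮 : Finset (α → Finset V), ∏ u ∈ I, m.choose (d u) ≤ 𝒮.card ∧
      ∀ S ∈ 𝒮, (∀ u ∈ I, (S u).card = d u ∧ Disjoint (S u) F) ∧ (∀ u ∉ I, S u = ∅) ∧
        ∀ u w, u ≠ w → Disjoint (S u) (S w) := by
  classical
  induction I using Finset.induction_on with
  | empty => exact ⟨{fun _ => ∅}, by simp, by simp⟩
  | insert a I ha ih =>
    rw [Finset.sum_insert ha] at hm
    obtain ⟨𝒮, h1, h2⟩ := ih (by omega)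
    let avail : (α → Finset V) → Finset V := fun S => (F ∪ I.biUnion S)ᶜ
    let T := 𝒮.sigma fun S => (avail S).powersetCard (d a)
    -- add the set of index `a` among the vertices which are still available
    refine ⟨T.image fun x => Function.update x.1 a x.2, ?_, ?_⟩
    · rw [Finset.card_image_of_injOn, Finset.card_sigma, Finset.prod_insert ha, mul_comm]
      · refine (Nat.mul_le_mul_right _ h1).trans ?_
        rw [← smul_eq_mul]
        refine Finset.card_nsmul_le_sum _ _ _ fun S hS => ?_
        rw [Finset.card_powersetCard]
        refine Nat.choose_le_choose _ ?_
        have h3 : (F ∪ I.biUnion S).card ≤ F.card + ∑ u ∈ I, d u :=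
          (Finset.card_union_le _ _).trans (Nat.add_le_add_left (Finset.card_biUnion_le.trans
            (Finset.sum_le_sum fun u hu => ((h2 S hS).1 u hu).1.le)) _)
        have h4 : (avail S).card = Fintype.card V - (F ∪ I.biUnion S).card :=
          Finset.card_compl _
        omega
      · rintro ⟨S, B⟩ hS ⟨S', B'⟩ hS' h
        simp only [Finset.coe_sigma, Set.mem_sigma_iff, Finset.mem_coe, T] at hS hS'
        simp only at h
        have hB : B = B' := by simpa using congrFun h a
        have hSS : S = S' := by
          ext1 u
          by_cases hu : u = a
          · rw [hu, ((h2 S hS.1).2.1 a ha), ((h2 S' hS'.1).2.1 a ha)]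
          · simpa [hu] using congrFun h u
        rw [hB, hSS]
    · simp only [Finset.mem_image, forall_exists_index, and_imp]
      rintro _ ⟨S, B⟩ hS rfl
      simp only [Finset.mem_sigma, Finset.mem_powersetCard, T] at hS
      obtain ⟨hS, hB, hBc⟩ := hS
      obtain ⟨i1, i2, i3⟩ := h2 S hS
      have hBF : Disjoint B F := by
        rw [Finset.disjoint_left]
        intro x hx hxF
        have := hB hx
        simp [avail, hxF] at this
      have hBS : ∀ u, Disjoint B (S u) := fun u => by
        rw [Finset.disjoint_left]
        intro x hx hxS
        have h5 := hB hx
        by_cases hu : u ∈ I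
        · simp only [Finset.compl_union, Finset.mem_inter, Finset.mem_compl, Finset.mem_biUnion,
            not_exists, not_and, avail] at h5
          exact h5.2 u hu hxS
        · rw [i2 u hu] at hxS
          simp at hxS
      refine ⟨fun u hu => ?_, fun u hu => ?_, fun u w huw => ?_⟩
      · by_cases h : u = a
        · rw [h, Function.update_self]
          exact ⟨hBc, hBF⟩
        · rw [Function.update_of_ne h]
          exact i1 u (Finset.mem_of_mem_insert_of_ne hu h)
      · rw [Finset.mem_insert, not_or] at hu
        rw [Function.update_of_ne hu.1]
        exact i2 u hu.2
      · by_cases h : u = a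
        · rw [h, Function.update_self, Function.update_of_ne fun h' => huw (h.trans h'.symm)]
          exact hBS w
        · rw [Function.update_of_ne h]
          by_cases h' : w = a
          · rw [h', Function.update_self]
            exact (hBS u).symm
          · rw [Function.update_of_ne h']
            exact i3 u w huw

/-- The `i`-th element of `A`, in increasing order; the junk value is `v`. -/
def nthElem (A : Finset V) (v : V) (i : ℕ) : V :=
  if h : i < A.card then A.orderEmbOfFin rfl ⟨i, h⟩ else v

/-- The vertex which carries the individual `u`, if the root is carried by `v` and the children of
`w` by the elements of `S w` in increasing order. -/
def label (S : List ℕ → Finset V) (v : V) : List ℕ → V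
  | [] => v
  | i :: u => nthElem (S u) v i

/-- The set which consists of the vertex which carries the parent of `u`. -/
def parentSet (S : List ℕ → Finset V) (v : V) : List ℕ → Finset V
  | [] => ∅
  | _ :: u => {label S v u}

theorem label_mem {S : List ℕ → Finset V} {v : V} {i : ℕ} {u : List ℕ} (h : i < (S u).card) :
    label S v (i :: u) ∈ S u := by
  rw [label, nthElem, dif_pos h]
  exact Finset.orderEmbOfFin_mem _ _ _

theorem exists_label_eq {S : List ℕ → Finset V} {v : V} {u : List ℕ} {x : V} (h : x ∈ S u) :
    ∃ i < (S u).card, label S v (i :: u) = x := by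
  have : x ∈ Set.range ((S u).orderEmbOfFin rfl) := by
    rw [Finset.range_orderEmbOfFin]; exact h
  obtain ⟨i, rfl⟩ := this
  exact ⟨i, i.2, by rw [label, nthElem, dif_pos i.2]⟩

theorem label_injective_of_lt {S : List ℕ → Finset V} {v : V} {i j : ℕ} {u : List ℕ}
    (hi : i < (S u).card) (hj : j < (S u).card) (h : label S v (i :: u) = label S v (j :: u)) :
    i = j := by
  rw [label, label, nthElem, nthElem, dif_pos hi, dif_pos hj] at h
  simpa using ((S u).orderEmbOfFin rfl).injective h

/-- The conditions under which `S` describes an embedding, with root `v`, of the tree with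
offspring numbers `t`, truncated at height `h`. -/
structure IsLabelling (h : ℕ) (t : List ℕ → ℕ) (v : V) (S : List ℕ → Finset V) : Prop where
  card_eq : ∀ u ∈ internal h t, (S u).card = t u
  notMem : ∀ u ∈ internal h t, v ∉ S u
  eq_empty : ∀ u ∉ internal h t, S u = ∅
  disjoint : ∀ u w, u ≠ w → Disjoint (S u) (S w)

variable {h : ℕ} {t : List ℕ → ℕ} {v : V} {S : List ℕ → Finset V}

theorem cons_mem {i : ℕ} {u : List ℕ} (hu : IsIndividual t (i :: u))
    (hh : (i :: u).length ≤ h) : u ∈ internal h t ∧ i < t u :=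
  ⟨mem_internal.2 ⟨hu.1, hh⟩, hu.2⟩

theorem IsLabelling.label_injOn (hS : IsLabelling h t v S) {u w : List ℕ}
    (hu : IsIndividual t u) (huh : u.length ≤ h) (hw : IsIndividual t w) (hwh : w.length ≤ h)
    (huw : label S v u = label S v w) : u = w := by
  have key : ∀ {i : ℕ} {u : List ℕ}, IsIndividual t (i :: u) → (i :: u).length ≤ h →
      u ∈ internal h t ∧ i < (S u).card := fun {i u} h1 h2 => by
    obtain ⟨h3, h4⟩ := cons_mem h1 h2
    exact ⟨h3, by rwa [hS.card_eq _ h3]⟩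
  cases u with
  | nil =>
    cases w with
    | nil => rfl
    | cons j w =>
      obtain ⟨h1, h2⟩ := key hw hwh
      refine absurd (label_mem (v := v) h2) ?_
      rw [← huw]
      exact hS.notMem w h1
  | cons i u =>
    obtain ⟨h1, h2⟩ := key hu huh
    cases w with
    | nil =>
      refine absurd (label_mem (v := v) h2) ?_
      rw [huw]
      exact hS.notMem u h1
    | cons j w =>
      obtain ⟨h3, h4⟩ := key hw hwh
      have e : u = w := by
        by_contra hne
        exact Finset.disjoint_left.1 (hS.disjoint u w hne) (huw ▸ label_mem (v := v) h2)
          (label_mem h4)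
      subst e
      rw [label_injective_of_lt h2 h4 huw]

/-- The graphs in which the edges at the vertices carrying the individuals of height less than `h`
are exactly the edges of the embedded tree. -/
def embedEvent (h : ℕ) (t : List ℕ → ℕ) (v : V) (S : List ℕ → Finset V) :
    Set (SimpleGraph V) :=
  {H | ∀ u ∈ internal h t, ∀ y, H.Adj (label S v u) y ↔ y ∈ S u ∨ y ∈ parentSet S v u}

theorem IsLabelling.disjoint_parentSet (hS : IsLabelling h t v S) {u : List ℕ}
    (hu : u ∈ internal h t) : Disjoint (S u) (parentSet S v u) := by
  cases u with
  | nil => simp [parentSet]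
  | cons i w =>
    rw [parentSet, Finset.disjoint_singleton_right]
    intro h1
    obtain ⟨j, hj, h2⟩ := exists_label_eq (v := v) h1
    rw [hS.card_eq _ hu] at hj
    obtain ⟨h3, h4⟩ := mem_internal.1 hu
    rw [List.length_cons] at h4
    have h5 := hS.label_injOn (u := j :: i :: w) ⟨h3, hj⟩ h4 h3.1 (by omega) h2
    have h6 := congrArg List.length h5
    simp only [List.length_cons] at h6
    omega

/-- The graph determines the tree and its embedding: the set `S u` consists of the neighbours of the
vertex which carries `u`, except the one which carries the parent of `u`. -/
theorem embedEvent_unique {t' : List ℕ → ℕ} {S' : List ℕ → Finset V}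
    (hS : IsLabelling h t v S) (hS' : IsLabelling h t' v S') (ht : trunc h t = t)
    (ht' : trunc h t' = t') {H : SimpleGraph V} (hH : H ∈ embedEvent h t v S)
    (hH' : H ∈ embedEvent h t' v S') : t = t' ∧ S = S' := by
  have key : ∀ u, (u ∈ internal h t ↔ u ∈ internal h t') ∧
      (u ∈ internal h t → label S v u = label S' v u ∧ S u = S' u) := by
    have step : ∀ u, u ∈ internal h t → u ∈ internal h t' → label S v u = label S' v u →
        parentSet S v u = parentSet S' v u → S u = S' u := by
      intro u h1 h2 h3 h4
      have h5 : S u ∪ parentSet S v u = S' u ∪ parentSet S' v u := by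
        ext y
        rw [Finset.mem_union, Finset.mem_union, ← hH u h1, ← hH' u h2, h3]
      rw [← Finset.union_sdiff_cancel_right (hS.disjoint_parentSet h1), h5, h4,
        Finset.union_sdiff_cancel_right (hS'.disjoint_parentSet h2)]
    intro u
    induction u with
    | nil =>
      have h1 : [] ∈ internal h t ↔ [] ∈ internal h t' := by
        simp [mem_internal, IsIndividual]
      exact ⟨h1, fun h2 => ⟨rfl, step [] h2 (h1.1 h2) rfl rfl⟩⟩
    | cons i w ih =>
      have h1 : ∀ s, i :: w ∈ internal h s ↔
          w ∈ internal h s ∧ i < s w ∧ w.length + 1 < h := fun s => by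
        simp only [mem_internal, IsIndividual, List.length_cons]
        constructor
        · rintro ⟨⟨a, b⟩, c⟩; exact ⟨⟨a, by omega⟩, b, c⟩
        · rintro ⟨⟨a, _⟩, b, c⟩; exact ⟨⟨a, b⟩, c⟩
      have h2 : i :: w ∈ internal h t ↔ i :: w ∈ internal h t' := by
        rw [h1, h1, ← ih.1]
        refine and_congr_right fun h3 => ?_
        rw [← hS.card_eq w h3, ← hS'.card_eq w (ih.1.1 h3), (ih.2 h3).2]
      refine ⟨h2, fun h3 => ?_⟩
      obtain ⟨h4, h5⟩ := ih.2 ((h1 t).1 h3).1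
      have h6 : label S v (i :: w) = label S' v (i :: w) := by
        rw [label, label, h5]
      exact ⟨h6, step _ h3 (h2.1 h3) h6 (by simp only [parentSet, h4])⟩
  have hSS : S = S' := by
    ext1 u
    by_cases hu : u ∈ internal h t
    · exact ((key u).2 hu).2
    · rw [hS.eq_empty u hu, hS'.eq_empty u (mt (key u).1.2 hu)]
  refine ⟨?_, hSS⟩
  ext u
  have h0 : ∀ s : List ℕ → ℕ, trunc h s = s → u ∉ internal h s → s u = 0 := fun s hs hu => by
    rw [mem_internal] at hu
    rw [← hs, trunc, if_neg hu]
  by_cases hu : u ∈ internal h t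
  · rw [← hS.card_eq u hu, hSS, hS'.card_eq u ((key u).1.1 hu)]
  · rw [h0 t ht hu, h0 t' ht' (mt (key u).1.2 hu)]

/-- The embedded tree looks like the graph up to height `h`. -/
theorem IsLabelling.returnProb_eq (hS : IsLabelling h t v S) {H : SimpleGraph V}
    (hH : H ∈ embedEvent h t v S) (c : ℝ≥0) {k : ℕ} (hk : k ≤ h) :
    returnProb H v c k = gwReturnProb c k t := by
  refine returnProb_eq_of_local_iso (v := gwRoot t) (fun u => label S v u.1)
    (fun u => u.1.length) (fun u => gwTree_neighborSet_finite _ _) rfl length_le_of_gwTree_adj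
    (fun u hu => ?_) (fun u hu e => Subtype.ext (hS.label_injOn u.2 hu trivial (Nat.zero_le _) e)) hk
  have huI : u.1 ∈ internal h t := mem_internal.2 ⟨u.2, hu⟩
  refine ⟨fun w hw => ?_, fun w hw w' hw' e => ?_, fun y hy => ?_⟩
  · rw [SimpleGraph.mem_neighborSet, hH u.1 huI]
    rcases hw with ⟨i, hi⟩ | ⟨i, hi⟩
    · left
      have := w.2
      rw [hi] at this
      change label S v w.1 ∈ S u.1
      rw [hi]
      exact label_mem (by rw [hS.card_eq _ huI]; exact this.2)
    · right
      rw [hi, parentSet, Finset.mem_singleton]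
  · have h1 := length_le_of_gwTree_adj _ _ hw
    have h2 := length_le_of_gwTree_adj _ _ hw'
    exact Subtype.ext (hS.label_injOn w.2 (by omega) w'.2 (by omega) e)
  · rw [SimpleGraph.mem_neighborSet, hH u.1 huI] at hy
    rcases hy with hy | hy
    · obtain ⟨i, hi, rfl⟩ := exists_label_eq (v := v) hy
      rw [hS.card_eq _ huI] at hi
      exact ⟨⟨i :: u.1, u.2, hi⟩, Or.inl ⟨i, rfl⟩, rfl⟩
    · obtain ⟨u, hu2⟩ := u
      cases u with
      | nil => simp [parentSet] at hy
      | cons i w =>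
        rw [parentSet, Finset.mem_singleton] at hy
        exact ⟨⟨w, hu2.1⟩, Or.inr ⟨i, rfl⟩, hy.symm⟩

/-- The event prescribes the edges `E₁` of the embedded tree, and the absence of all the other pairs
`E₀` which meet a vertex carrying an individual of height less than `h`. -/
theorem IsLabelling.le_embedEvent (hS : IsLabelling h t v S) (q : unitInterval) :
    (q : ℝ) ^ (∑ u ∈ internal h t, t u) * (1 - q) ^ ((internal h t).card * Fintype.card V) ≤
      (SimpleGraph.binomialRandom V q).real (embedEvent h t v S) := by
  have hq0 : (0 : ℝ) ≤ q := q.2.1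
  have hq1 : (q : ℝ) ≤ 1 := q.2.2
  let E₁ : Finset (Sym2 V) :=
    (internal h t).biUnion fun u => (Finset.range (t u)).image fun i =>
      s(label S v u, label S v (i :: u))
  let E₀ : Finset (Sym2 V) :=
    ((internal h t ×ˢ Finset.univ).image fun x : List ℕ × V => s(label S v x.1, x.2)) \ E₁
  have hE₁ : E₁.card ≤ ∑ u ∈ internal h t, t u :=
    Finset.card_biUnion_le.trans (Finset.sum_le_sum fun u _ =>
      Finset.card_image_le.trans_eq (Finset.card_range _))
  have hE₀ : E₀.card ≤ (internal h t).card * Fintype.card V :=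
    (Finset.card_le_card Finset.sdiff_subset).trans (Finset.card_image_le.trans_eq (by
      rw [Finset.card_product, Finset.card_univ]))
  have mem1 : ∀ e, e ∈ E₁ ↔
      ∃ u ∈ internal h t, ∃ i < t u, s(label S v u, label S v (i :: u)) = e := fun e => by
    simp [E₁]
  have hcons : ∀ u ∈ internal h t, ∀ i < t u,
      IsIndividual t (i :: u) ∧ (i :: u).length ≤ h := fun u hu i hi => by
    obtain ⟨h1, h2⟩ := mem_internal.1 hu
    exact ⟨⟨h1, hi⟩, h2⟩
  have hdiag : ∀ e ∈ E₁, ¬ e.IsDiag := by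
    intro e he
    obtain ⟨u, hu, i, hi, rfl⟩ := (mem1 e).1 he
    rw [Sym2.mk_isDiag_iff]
    intro h1
    obtain ⟨h2, h3⟩ := hcons u hu i hi
    have h4 := hS.label_injOn (mem_internal.1 hu).1 (mem_internal.1 hu).2.le h2 h3 h1
    simpa using congrArg List.length h4
  refine le_trans ?_ ((le_binomialRandom_real q hdiag Finset.disjoint_sdiff).trans
    (measureReal_mono ?_ (measure_ne_top _ _)) : (q : ℝ) ^ E₁.card * (1 - q) ^ E₀.card ≤ _)
  · exact mul_le_mul (pow_le_pow_of_le_one hq0 hq1 hE₁)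
      (pow_le_pow_of_le_one (by linarith) (by linarith) hE₀) (pow_nonneg (by linarith) _)
      (pow_nonneg hq0 _)
  · rintro H ⟨h1, h0⟩ u hu y
    have hadj : H.Adj (label S v u) y ↔ s(label S v u, y) ∈ E₁ := by
      rw [← SimpleGraph.mem_edgeSet]
      refine ⟨fun h2 => ?_, fun h2 => h1 _ h2⟩
      by_contra h3
      refine h0 _ (Finset.mem_sdiff.2 ⟨?_, h3⟩) h2
      exact Finset.mem_image.2 ⟨(u, y), by simp [hu], rfl⟩
    rw [hadj, mem1]
    constructor
    · rintro ⟨w, hw, i, hi, h2⟩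
      obtain ⟨h5, h6⟩ := hcons w hw i hi
      rcases Sym2.eq_iff.1 h2 with ⟨h3, h4⟩ | ⟨h3, h4⟩
      · left
        have : w = u := hS.label_injOn (mem_internal.1 hw).1 (mem_internal.1 hw).2.le
          (mem_internal.1 hu).1 (mem_internal.1 hu).2.le h3
        subst this
        rw [← h4]
        exact label_mem (by rwa [hS.card_eq _ hw])
      · right
        have : i :: w = u := hS.label_injOn h5 h6
          (mem_internal.1 hu).1 (mem_internal.1 hu).2.le h4
        rw [← this, ← h3, parentSet, Finset.mem_singleton]
    · rintro (h2 | h2)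
      · obtain ⟨i, hi, rfl⟩ := exists_label_eq (v := v) h2
        exact ⟨u, hu, i, by rwa [← hS.card_eq _ hu], rfl⟩
      · cases u with
        | nil => simp [parentSet] at h2
        | cons i w =>
          rw [parentSet, Finset.mem_singleton] at h2
          obtain ⟨h3, h4⟩ := mem_internal.1 hu
          refine ⟨w, mem_internal.2 ⟨h3.1, ?_⟩, i, h3.2, ?_⟩
          · rw [List.length_cons] at h4; omega
          · rw [h2, Sym2.eq_swap]

end Exploration

/-! ### Local convergence to the Galton–Watson tree -/

section LocalLimit

/-- The events `embedEvent h t v S`, for distinct pairs `(t, S)`, are disjoint, so that their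
probabilities may be added. -/
theorem sum_le_integral_binomialRandom {V : Type*} [Fintype V] [LinearOrder V] (v : V)
    (q : unitInterval) (h : ℕ) (𝒯 : Finset (List ℕ →₀ ℕ)) (h𝒯 : ∀ t ∈ 𝒯, trunc h t = t)
    {f : SimpleGraph V → ℝ} (hf : ∀ H, 0 ≤ f H) {g : (List ℕ → ℕ) → ℝ} (hg : ∀ t, 0 ≤ g t)
    (hfg : ∀ t S H, IsLabelling h t v S → H ∈ embedEvent h t v S → f H = g t)
    (m : ℕ) (hm : ∀ t ∈ 𝒯, m + 1 + ∑ u ∈ internal h t, t u ≤ Fintype.card V) :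
    ∑ t ∈ 𝒯, (∏ u ∈ internal h t, ((m.choose (t u) : ℝ) * (q : ℝ) ^ t u *
      (1 - q) ^ Fintype.card V)) * g t ≤ ∫ H, f H ∂(SimpleGraph.binomialRandom V q) := by
  have hq1 : (0 : ℝ) ≤ 1 - q := by linarith [q.2.2]
  have hex : ∀ t : List ℕ →₀ ℕ, ∃ 𝒮 : Finset (List ℕ → Finset V), t ∈ 𝒯 →
      ∏ u ∈ internal h t, m.choose (t u) ≤ 𝒮.card ∧ ∀ S ∈ 𝒮, IsLabelling h t v S := by
    intro t
    by_cases ht : t ∈ 𝒯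
    · obtain ⟨𝒮, h1, h2⟩ := exists_disjoint_families {v} t m (internal h t) (by
        rw [Finset.card_singleton]; exact hm t ht)
      refine ⟨𝒮, fun _ => ⟨h1, fun S hS => ?_⟩⟩
      obtain ⟨h3, h4, h5⟩ := h2 S hS
      exact ⟨fun u hu => (h3 u hu).1, fun u hu => Finset.disjoint_singleton_right.1 (h3 u hu).2,
        h4, h5⟩
    · exact ⟨∅, fun h1 => absurd h1 ht⟩
  choose 𝒮 h𝒮 using hex
  set X := 𝒯.sigma 𝒮
  have hX : ∀ x ∈ X, x.1 ∈ 𝒯 ∧ IsLabelling h x.1 v x.2 := fun x hx => by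
    rw [Finset.mem_sigma] at hx
    exact ⟨hx.1, (h𝒮 x.1 hx.1).2 x.2 hx.2⟩
  have hpt : ∀ H, ∑ x ∈ X, (embedEvent h x.1 v x.2).indicator (fun _ => g x.1) H ≤ f H := by
    intro H
    by_cases hH : ∃ x ∈ X, H ∈ embedEvent h x.1 v x.2
    · obtain ⟨x, hx, hxH⟩ := hH
      rw [Finset.sum_eq_single_of_mem x hx, Set.indicator_of_mem hxH,
        hfg _ _ H (hX x hx).2 hxH]
      intro y hy hyx
      refine Set.indicator_of_notMem (fun hyH => hyx ?_) _
      obtain ⟨h1, h2⟩ := embedEvent_unique (hX y hy).2 (hX x hx).2 (h𝒯 _ (hX y hy).1)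
        (h𝒯 _ (hX x hx).1) hyH hxH
      exact Sigma.ext (DFunLike.coe_injective h1) (heq_of_eq h2)
    · rw [Finset.sum_eq_zero]
      · exact hf H
      · intro x hx
        exact Set.indicator_of_notMem (fun h1 => hH ⟨x, hx, h1⟩) _
  refine le_trans ?_ (integral_mono Integrable.of_finite Integrable.of_finite hpt)
  rw [integral_finsetSum _ fun _ _ => Integrable.of_finite, Finset.sum_sigma]
  refine Finset.sum_le_sum fun t ht => ?_
  obtain ⟨h1, h2⟩ := h𝒮 t ht
  set w : ℝ := (q : ℝ) ^ (∑ u ∈ internal h t, t u) *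
    (1 - q) ^ ((internal h t).card * Fintype.card V)
  have hw : 0 ≤ w := mul_nonneg (pow_nonneg q.2.1 _) (pow_nonneg hq1 _)
  have hprod : ∏ u ∈ internal h t, ((m.choose (t u) : ℝ) * (q : ℝ) ^ t u *
      (1 - q) ^ Fintype.card V) = ((∏ u ∈ internal h t, m.choose (t u) : ℕ) : ℝ) * w := by
    rw [Finset.prod_mul_distrib, Finset.prod_mul_distrib, Finset.prod_pow_eq_pow_sum,
      Finset.prod_const, ← pow_mul, mul_comm (Fintype.card V), mul_assoc, Nat.cast_prod]
  calc _ ≤ ((𝒮 t).card : ℝ) * w * g t := by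
        rw [hprod]
        have : ((∏ u ∈ internal h t, m.choose (t u) : ℕ) : ℝ) ≤ (𝒮 t).card := by exact_mod_cast h1
        have := hg t
        gcongr
    _ = ∑ S ∈ 𝒮 t, w * g t := by rw [Finset.sum_const, nsmul_eq_mul, mul_assoc]
    _ ≤ _ := by
      refine Finset.sum_le_sum fun S hS => ?_
      rw [integral_indicator_const _ (Set.toFinite _).measurableSet, smul_eq_mul]
      exact mul_le_mul_of_nonneg_right ((h2 S hS).le_embedEvent q) (hg t)

theorem tendsto_choose_sub_mul_pow (p : ℝ) (K d : ℕ) :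
    Tendsto (fun n : ℕ => ((n - K).choose d : ℝ) * (p / n) ^ d * (1 - p / n) ^ n) atTop
      (𝓝 (Real.exp (-p) * p ^ d / d.factorial)) := by
  have h1 : Tendsto (fun m : ℕ => (m : ℝ) * (p / ((m + K : ℕ) : ℝ))) atTop (𝓝 p) := by
    have h2 : Tendsto (fun m : ℕ => (m : ℝ) / (m + K)) atTop (𝓝 1) :=
      tendsto_natCast_div_add_atTop (K : ℝ)
    simpa [mul_div_assoc, mul_comm p, div_mul_eq_mul_div] using h2.const_mul p
  have h3 := (tendsto_choose_mul_pow_atTop d h1).comp (tendsto_sub_atTop_nat K)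
  have h4 : Tendsto (fun n : ℕ => (1 - p / n) ^ n) atTop (𝓝 (Real.exp (-p))) := by
    simpa [neg_div, sub_eq_add_neg] using Real.tendsto_one_add_div_pow_exp (-p)
  rw [mul_div_assoc, mul_comm (Real.exp (-p))]
  refine (h3.mul h4).congr' ?_
  filter_upwards [eventually_ge_atTop K] with n hn
  simp only [Function.comp_apply, Nat.sub_add_cancel hn]

/-- A lower bound, uniform in the root, for the expectation of a functional of `G(n, p/n)` which is
a function of the tree whenever the neighbourhood of height `h` of the root is a tree. Since the
limiting probabilities of the trees add up to `1`, applying it to a functional with values in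
`[0, 1]` and to its complement to `1` yields convergence of expectations. -/
theorem eventually_lt_integral_binomialRandom (p : ℝ≥0) (h : ℕ) {g : (List ℕ → ℕ) → ℝ}
    (hg0 : ∀ t, 0 ≤ g t) (hg1 : ∀ t, g t ≤ 1) (hg : ∀ t, g (trunc h t) = g t) {a : ℝ}
    (ha : a < ∫ ξ, g ξ ∂(offspringLaw p)) :
    ∀ᶠ n : ℕ in atTop, ∀ (hn : (p : ℝ) < n) (v : Fin n) (f : SimpleGraph (Fin n) → ℝ),
      (∀ H, 0 ≤ f H) →
      (∀ t S H, IsLabelling h t v S → H ∈ embedEvent h t v S → f H = g t) →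
      a < ∫ H, f H ∂(SimpleGraph.binomialRandom (Fin n) (edgeProb p n hn)) := by
  classical
  obtain ⟨-, hsum⟩ := integrable_and_hasSum_trunc p h hg0 hg1 hg
  obtain ⟨𝒯₀, h𝒯₀⟩ := (hsum.eventually (lt_mem_nhds ha)).exists
  set 𝒯 : Finset (List ℕ →₀ ℕ) := 𝒯₀.filter fun t : List ℕ →₀ ℕ => trunc h t = t
  have h𝒯 : ∀ t ∈ 𝒯, trunc h t = t := fun t ht => (Finset.mem_filter.1 ht).2
  have h1 : a < ∑ t ∈ 𝒯, gwProb p h t * g t := by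
    rwa [Finset.sum_filter_of_ne]
    intro t _ ht
    by_contra h2
    exact ht (by rw [gwProb_eq_zero p h2, zero_mul])
  -- `n - K` vertices remain available throughout the construction of the embeddings
  set K := 1 + ∑ t ∈ 𝒯, ∑ u ∈ internal h t, t u
  have hlim : Tendsto (fun n : ℕ => ∑ t ∈ 𝒯, (∏ u ∈ internal h t,
      (((n - K).choose (t u) : ℝ) * ((p : ℝ) / n) ^ t u * (1 - (p : ℝ) / n) ^ n)) * g t) atTop
      (𝓝 (∑ t ∈ 𝒯, gwProb p h t * g t)) := by
    refine tendsto_finsetSum _ fun t ht => ?_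
    rw [gwProb_eq_prod p (h𝒯 t ht)]
    exact (tendsto_finsetProd _ fun u _ => tendsto_choose_sub_mul_pow p K (t u)).mul_const _
  filter_upwards [hlim.eventually (lt_mem_nhds h1), eventually_ge_atTop K] with n hn1 hnK hn v f
    hf hfg
  have h3 := sum_le_integral_binomialRandom v (edgeProb p n hn) h 𝒯 h𝒯 hf hg0 hfg (n - K)
    fun t ht => by
      have : ∑ u ∈ internal h t, t u ≤ ∑ t ∈ 𝒯, ∑ u ∈ internal h t, t u :=
        Finset.single_le_sum (f := fun t : List ℕ →₀ ℕ => ∑ u ∈ internal h t, t u)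
          (fun _ _ => Nat.zero_le _) ht
      rw [Fintype.card_fin]
      omega
  rw [Fintype.card_fin] at h3
  exact hn1.trans_le h3

/-- Convergence of the expected moments of the spectral distribution of `K`. -/
theorem eventually_abs_integral_trace_sub_le (p c : ℝ≥0) (k : ℕ) {ε : ℝ} (hε : 0 < ε) :
    ∀ᶠ n : ℕ in atTop, ∀ hn : (p : ℝ) < n,
      |∫ H, (matK c H ^ k).trace ∂(SimpleGraph.binomialRandom (Fin n) (edgeProb p n hn))
        - n * gwMoment p c k| ≤ n * ε := by
  have e1 := eventually_lt_integral_binomialRandom p k (gwReturnProb_nonneg c k)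
    (gwReturnProb_le_one c k) (fun _ => gwReturnProb_trunc le_rfl)
    (a := gwMoment p c k - ε) (by rw [gwMoment]; linarith)
  have e2 := eventually_lt_integral_binomialRandom p k (g := fun ξ => 1 - gwReturnProb c k ξ)
    (fun t => by linarith [gwReturnProb_le_one c k t])
    (fun t => by linarith [gwReturnProb_nonneg c k t])
    (fun _ => by rw [gwReturnProb_trunc le_rfl]) (a := 1 - gwMoment p c k - ε) (by
      rw [integral_sub (integrable_const _) (integrable_gwReturnProb p c k), gwMoment]
      simp only [integral_const, probReal_univ, smul_eq_mul]
      linarith)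
  filter_upwards [e1, e2] with n h1 h2 hn
  have key : ∀ v : Fin n, |∫ H, returnProb H v c k
      ∂(SimpleGraph.binomialRandom (Fin n) (edgeProb p n hn)) - gwMoment p c k| ≤ ε := fun v => by
    have h3 := h1 hn v (fun H => returnProb H v c k) (fun H => returnProb_nonneg _ _)
      fun t S H hS hH => hS.returnProb_eq hH c le_rfl
    have h4 := h2 hn v (fun H => 1 - returnProb H v c k)
      (fun H => by linarith [returnProb_le_one (G := H) (c := c) v k])
      fun t S H hS hH => by simp only [hS.returnProb_eq hH c le_rfl]
    rw [integral_sub Integrable.of_finite Integrable.of_finite] at h4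
    simp only [integral_const, probReal_univ, smul_eq_mul] at h4
    rw [abs_le]
    constructor <;> linarith
  simp only [trace_matK_pow]
  rw [integral_finsetSum _ fun _ _ => Integrable.of_finite]
  have h5 : (n : ℝ) * gwMoment p c k = ∑ _v : Fin n, gwMoment p c k := by simp
  rw [h5, ← Finset.sum_sub_distrib]
  refine (Finset.abs_sum_le_sum_abs _ _).trans ((Finset.sum_le_sum fun v _ => key v).trans ?_)
  simp

end LocalLimit

/-! ### Concentration of the moments -/

section Concentration

/-- Chebyshev's inequality: the trace of `K ^ k` has variance of order `n`, since there are of order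
`n²` pairs of vertices, each present with probability of order `1 / n`. -/
theorem prob_abs_trace_sub_ge_le (p c : ℝ≥0) (k : ℕ) {ε : ℝ} (hε : 0 < ε) :
    ∀ᶠ n : ℕ in atTop, ∀ hn : (p : ℝ) < n,
      (SimpleGraph.binomialRandom (Fin n) (edgeProb p n hn)).real
        {H | ε ≤ |(matK c H ^ k).trace / n - gwMoment p c k|} ≤
        (p * (4 * k) ^ 2 / (ε / 2) ^ 2) / n := by
  filter_upwards [eventually_abs_integral_trace_sub_le p c k (half_pos hε),
    eventually_gt_atTop 0] with n h1 hn0 hn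
  specialize h1 hn
  set μ := SimpleGraph.binomialRandom (Fin n) (edgeProb p n hn)
  have hn0' : (0 : ℝ) < n := by exact_mod_cast hn0
  set m := ∫ H, (matK c H ^ k).trace ∂μ
  have h2 : ∫ H, ((matK c H ^ k).trace - m) ^ 2 ∂μ ≤ n * (p * (4 * k) ^ 2) := by
    have := integral_sq_sub_le_binomialRandom (edgeProb p n hn)
      (fun H : SimpleGraph (Fin n) => (matK c H ^ k).trace) (L := 4 * k)
      fun H H' u v huv => abs_trace_matK_pow_sub_le c u v huv k
    refine this.trans_eq ?_
    have h3 : ((edgeProb p n hn : unitInterval) : ℝ) = p / n := rfl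
    rw [h3, Fintype.card_fin]
    field_simp
  have h4 : {H : SimpleGraph (Fin n) | ε ≤ |(matK c H ^ k).trace / n - gwMoment p c k|} ⊆
      {H | (n * (ε / 2)) ^ 2 ≤ ((matK c H ^ k).trace - m) ^ 2} := by
    intro H hH
    simp only [Set.mem_ofPred_eq] at hH ⊢
    rw [← sq_abs ((matK c H ^ k).trace - m)]
    refine pow_le_pow_left₀ (by positivity) ?_ 2
    have h5 : n * ε ≤ |(matK c H ^ k).trace - n * gwMoment p c k| := by
      have : (matK c H ^ k).trace - n * gwMoment p c k =
          n * ((matK c H ^ k).trace / n - gwMoment p c k) := by field_simp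
      rw [this, abs_mul, abs_of_pos hn0']
      gcongr
    have h6 := abs_sub_le (matK c H ^ k).trace m (n * gwMoment p c k)
    linarith
  have h7 := mul_meas_ge_le_integral_of_nonneg (μ := μ)
    (f := fun H => ((matK c H ^ k).trace - m) ^ 2) (Eventually.of_forall fun H => sq_nonneg _)
    Integrable.of_finite ((n * (ε / 2)) ^ 2)
  refine (measureReal_mono h4 (measure_ne_top _ _)).trans ?_
  rw [← mul_le_mul_iff_right₀ (by positivity : (0 : ℝ) < (n * (ε / 2)) ^ 2)]
  refine (h7.trans h2).trans_eq ?_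
  field_simp

end Concentration

/-! ### The moment problem on a compact interval -/

section Moments

variable {B : ℝ}

theorem ae_mem_Icc {ν : Measure ℝ} (h : ν (Set.Icc (-B) B)ᶜ = 0) : ∀ᵐ x ∂ν, x ∈ Set.Icc (-B) B :=
  h

theorem integrable_of_continuous {ν : Measure ℝ} [IsFiniteMeasure ν]
    (h : ν (Set.Icc (-B) B)ᶜ = 0) {f : ℝ → ℝ} (hf : Continuous f) : Integrable f ν := by
  obtain ⟨C, hC⟩ := isCompact_Icc.exists_bound_of_continuousOn (s := Set.Icc (-B) B) hf.continuousOn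
  exact Integrable.of_bound hf.aestronglyMeasurable C ((ae_mem_Icc h).mono fun x hx => hC x hx)

/-- For probability measures on a fixed compact interval, finitely many moments control the
integral of a given continuous function. -/
theorem exists_moment_control (B : ℝ) (f : ℝ →ᵇ ℝ) {ε : ℝ} (hε : 0 < ε) :
    ∃ (N : ℕ) (δ : ℝ), 0 < δ ∧ ∀ (ν μ : Measure ℝ) [IsProbabilityMeasure ν]
      [IsProbabilityMeasure μ], ν (Set.Icc (-B) B)ᶜ = 0 → μ (Set.Icc (-B) B)ᶜ = 0 →
      (∀ k < N, |∫ x, x ^ k ∂ν - ∫ x, x ^ k ∂μ| < δ) → |∫ x, f x ∂ν - ∫ x, f x ∂μ| < ε := by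
  obtain ⟨P, hP⟩ := exists_polynomial_near_of_continuousOn (-B) B f f.continuous.continuousOn
    (ε / 3) (by positivity)
  set A := ∑ k ∈ Finset.range (P.natDegree + 1), |P.coeff k|
  have hA : 0 ≤ A := Finset.sum_nonneg fun _ _ => abs_nonneg _
  refine ⟨P.natDegree + 1, ε / 3 / (A + 1), by positivity, fun ν μ _ _ hν hμ hk => ?_⟩
  have h1 : ∀ (ρ : Measure ℝ) [IsProbabilityMeasure ρ], ρ (Set.Icc (-B) B)ᶜ = 0 →
      |∫ x, f x ∂ρ - ∫ x, P.eval x ∂ρ| ≤ ε / 3 := by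
    intro ρ _ hρ
    rw [← integral_sub (integrable_of_continuous hρ f.continuous)
      (integrable_of_continuous hρ P.continuous)]
    have := norm_integral_le_of_norm_le_const (μ := ρ) (f := fun x => f x - P.eval x)
      (C := ε / 3) ((ae_mem_Icc hρ).mono fun x hx => by
        rw [Real.norm_eq_abs, abs_sub_comm]; exact (hP x hx).le)
    simpa using this
  have h2 : ∀ (ρ : Measure ℝ) [IsProbabilityMeasure ρ], ρ (Set.Icc (-B) B)ᶜ = 0 →
      ∫ x, P.eval x ∂ρ = ∑ k ∈ Finset.range (P.natDegree + 1), P.coeff k * ∫ x, x ^ k ∂ρ := by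
    intro ρ _ hρ
    simp_rw [Polynomial.eval_eq_sum_range]
    rw [integral_finsetSum _ fun k _ =>
      (integrable_of_continuous hρ (continuous_pow k)).const_mul _]
    simp_rw [integral_const_mul]
  have h3 : |∫ x, P.eval x ∂ν - ∫ x, P.eval x ∂μ| < ε / 3 := by
    rw [h2 ν hν, h2 μ hμ, ← Finset.sum_sub_distrib]
    calc _ ≤ ∑ k ∈ Finset.range (P.natDegree + 1), |P.coeff k| * (ε / 3 / (A + 1)) := by
          refine (Finset.abs_sum_le_sum_abs _ _).trans (Finset.sum_le_sum fun k hk' => ?_)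
          rw [← mul_sub, abs_mul]
          exact mul_le_mul_of_nonneg_left (hk k (Finset.mem_range.1 hk')).le (abs_nonneg _)
      _ = A * (ε / 3 / (A + 1)) := by rw [Finset.sum_mul]
      _ < (A + 1) * (ε / 3 / (A + 1)) := by gcongr; linarith
      _ = ε / 3 := by field_simp
  have h4 := abs_le.1 (h1 ν hν)
  have h5 := abs_le.1 (h1 μ hμ)
  rw [abs_lt] at h3 ⊢
  constructor <;> linarith

theorem measure_eq_of_moments_eq {μ ν : Measure ℝ} [IsProbabilityMeasure μ]
    [IsProbabilityMeasure ν] (hν : ν (Set.Icc (-B) B)ᶜ = 0) (hμ : μ (Set.Icc (-B) B)ᶜ = 0)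
    (h : ∀ k : ℕ, ∫ x, x ^ k ∂ν = ∫ x, x ^ k ∂μ) : ν = μ := by
  refine ext_of_forall_integral_eq_of_IsFiniteMeasure fun f => ?_
  refine eq_of_abs_sub_nonpos (le_of_forall_gt fun ε hε => ?_)
  obtain ⟨N, δ, hδ, h1⟩ := exists_moment_control B f hε
  exact h1 ν μ hν hμ fun k _ => by rw [h, sub_self, abs_zero]; exact hδ

/-- Probability measures on a compact interval whose moments converge have a limit. -/
theorem exists_measure_of_tendsto_moments {ν : ℕ → Measure ℝ} [∀ n, IsProbabilityMeasure (ν n)]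
    (hB : 0 ≤ B) (hν : ∀ n, ν n (Set.Icc (-B) B)ᶜ = 0) {m : ℕ → ℝ}
    (hm : ∀ k, Tendsto (fun n => ∫ x, x ^ k ∂(ν n)) atTop (𝓝 (m k))) :
    ∃ μ : Measure ℝ, IsProbabilityMeasure μ ∧ μ (Set.Icc (-B) B)ᶜ = 0 ∧
      ∀ k, ∫ x, x ^ k ∂μ = m k := by
  have hcpt := isCompact_setOfPred_probabilityMeasure_mass_eq_compl_isCompact_le (E := ℝ)
    (u := fun _ => 0) (K := fun _ => Set.Icc (-B) B) tendsto_const_nhds (fun _ => isCompact_Icc)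
    (Or.inl inferInstance)
  let ν' : ℕ → ProbabilityMeasure ℝ := fun n => ⟨ν n, inferInstance⟩
  obtain ⟨μ, hμ, hlim⟩ := hcpt.ultrafilter_le_nhds ((hyperfilter ℕ).map ν') (by
    rw [le_principal_iff, Ultrafilter.mem_coe, Ultrafilter.mem_map]
    refine Filter.univ_mem' fun n _ => ?_
    rw [nonpos_iff_eq_zero, ProbabilityMeasure.null_iff_toMeasure_null]
    exact hν n)
  have hμ0 : (μ : Measure ℝ) (Set.Icc (-B) B)ᶜ = 0 := by
    rw [← ProbabilityMeasure.null_iff_toMeasure_null, ← nonpos_iff_eq_zero]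
    exact hμ 0
  refine ⟨μ, inferInstance, hμ0, fun k => ?_⟩
  have hlim' : Tendsto ν' (hyperfilter ℕ) (𝓝 μ) := hlim
  rw [ProbabilityMeasure.tendsto_iff_forall_integral_tendsto] at hlim'
  -- the monomial, modified outside of the interval so as to be bounded
  let f : ℝ →ᵇ ℝ := BoundedContinuousFunction.ofNormedAddCommGroup
    (fun x => (max (-B) (min B x)) ^ k) (by fun_prop) (B ^ k) fun x => by
      rw [norm_pow, Real.norm_eq_abs]
      refine pow_le_pow_left₀ (abs_nonneg _) (abs_le.2 ⟨le_max_left _ _, ?_⟩) k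
      exact max_le (by linarith) (min_le_left _ _)
  have hf : ∀ ρ : Measure ℝ, ρ (Set.Icc (-B) B)ᶜ = 0 → ∫ x, f x ∂ρ = ∫ x, x ^ k ∂ρ :=
    fun ρ hρ => integral_congr_ae ((ae_mem_Icc hρ).mono fun x hx => by
      change (max (-B) (min B x)) ^ k = x ^ k
      rw [min_eq_right hx.2, max_eq_right hx.1])
  have h1 := hlim' f
  rw [hf _ hμ0] at h1
  refine tendsto_nhds_unique h1 (((hm k).mono_left Nat.hyperfilter_le_atTop).congr fun n => ?_)
  exact (hf _ (hν n)).symm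

end Moments

/-! ### The limiting measure -/

section Limit

theorem exists_limit_measure (p c : ℝ≥0) :
    ∃ μ : Measure ℝ, IsProbabilityMeasure μ ∧ μ (Set.Icc (-1) 1)ᶜ = 0 ∧
      ∀ k, ∫ x, x ^ k ∂μ = gwMoment p c k := by
  classical
  -- the expected spectral distributions
  let ν : ℕ → Measure ℝ := fun n => if hn : (p : ℝ) < n then
    ∑ H, SimpleGraph.binomialRandom (Fin n) (edgeProb p n hn) {H} • esd (matK c H)
    else Measure.dirac 0
  have hspec : ∀ n : ℕ, (p : ℝ) < n → ∀ H : SimpleGraph (Fin n),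
      IsProbabilityMeasure (esd (matK c H)) ∧ esd (matK c H) (Set.Icc (-1) 1)ᶜ = 0 ∧
      ∀ k : ℕ, ∫ x, x ^ k ∂(esd (matK c H)) = (matK c H ^ k).trace / n := fun n hn H => by
    have hn0 : 0 < n := by
      have : (0 : ℝ) < n := (NNReal.coe_nonneg p).trans_lt hn
      exact_mod_cast this
    have : Nonempty (Fin n) := ⟨⟨0, hn0⟩⟩
    simpa using (symmetrizable_matK c H).esd_spec (rowBdd_matK c H)
  have hνn : ∀ (n : ℕ) (hn : (p : ℝ) < n), ν n =
      ∑ H, SimpleGraph.binomialRandom (Fin n) (edgeProb p n hn) {H} • esd (matK c H) :=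
    fun n hn => dif_pos hn
  have hprob : ∀ n, IsProbabilityMeasure (ν n) := fun n => by
    by_cases hn : (p : ℝ) < n
    · constructor
      rw [hνn n hn, Measure.finsetSum_apply]
      simp only [Measure.smul_apply, smul_eq_mul]
      have : ∀ H : SimpleGraph (Fin n), esd (matK c H) Set.univ = 1 := fun H =>
        (hspec n hn H).1.measure_univ
      simp only [this, mul_one]
      rw [sum_measure_singleton, Finset.coe_univ, measure_univ]
    · simp only [ν, dif_neg hn]
      infer_instance
  have hsupp : ∀ n, ν n (Set.Icc (-1) 1)ᶜ = 0 := fun n => by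
    by_cases hn : (p : ℝ) < n
    · rw [hνn n hn, Measure.finsetSum_apply]
      refine Finset.sum_eq_zero fun H _ => ?_
      rw [Measure.smul_apply, (hspec n hn H).2.1, smul_zero]
    · simp only [ν, dif_neg hn]
      rw [Measure.dirac_apply' _ measurableSet_Icc.compl]
      simp
  refine exists_measure_of_tendsto_moments zero_le_one hsupp fun k => ?_
  rw [Metric.tendsto_atTop']
  intro ε hε
  have h1 := (eventually_abs_integral_trace_sub_le p c k (half_pos hε)).and
    (tendsto_natCast_atTop_atTop.eventually (eventually_gt_atTop (p : ℝ)))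
  obtain ⟨N, hN⟩ := eventually_atTop.1 h1
  refine ⟨N, fun n hn => ?_⟩
  obtain ⟨h2, h3⟩ := hN n hn.le
  have hn0 : (0 : ℝ) < n := (NNReal.coe_nonneg p).trans_lt h3
  have h4 : ∫ x, x ^ k ∂(ν n) = (∫ H, (matK c H ^ k).trace
      ∂(SimpleGraph.binomialRandom (Fin n) (edgeProb p n h3))) / n := by
    rw [hνn n h3, integral_finsetSum_measure fun H _ => ?_, integral_fintype Integrable.of_finite,
      Finset.sum_div]
    · refine Finset.sum_congr rfl fun H _ => ?_
      rw [integral_smul_measure, (hspec n h3 H).2.2, smul_eq_mul, smul_eq_mul, mul_div_assoc,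
        measureReal_def]
    · have := (hspec n h3 H).1
      exact (integrable_of_continuous (hspec n h3 H).2.1 (continuous_pow k)).smul_measure
        (measure_ne_top _ _)
  have h5 := h2 h3
  rw [Real.dist_eq, h4]
  have h6 : ∀ x : ℝ, x / n - gwMoment p c k = (x - n * gwMoment p c k) / n := fun x => by
    field_simp
  rw [h6, abs_div, abs_of_pos hn0, div_lt_iff₀ hn0]
  nlinarith

end Limit

/-! ### Convergence of the spectral distributions -/

section Convergence

variable {p c : ℝ≥0} {X : (n : ℕ) → SimpleGraph (Fin n) → Matrix (Fin n) (Fin n) ℝ} {C : ℝ}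
  {μ : Measure ℝ}

theorem esd_spec_of_abs_sub_le (hX : ∀ n H, Symmetrizable (X n H))
    (hXC : ∀ n H i j, |(X n H - matK c H) i j| ≤ C / n) {n : ℕ} (hn : 0 < n)
    (H : SimpleGraph (Fin n)) :
    IsProbabilityMeasure (esd (X n H)) ∧ esd (X n H) (Set.Icc (-(1 + C)) (1 + C))ᶜ = 0 ∧
      ∀ k : ℕ, ∫ x, x ^ k ∂(esd (X n H)) = (X n H ^ k).trace / n := by
  have : Nonempty (Fin n) := ⟨⟨0, hn⟩⟩
  simpa using (hX n H).esd_spec (rowBdd_of_abs_sub_matK_le c H (by simpa using hXC n H))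

theorem prob_abs_moment_sub_ge_le (p : ℝ≥0) (hC : 0 ≤ C) (hX : ∀ n H, Symmetrizable (X n H))
    (hXC : ∀ n H i j, |(X n H - matK c H) i j| ≤ C / n) (k : ℕ) {ε : ℝ} (hε : 0 < ε) :
    ∃ R : ℝ, ∀ᶠ n : ℕ in atTop, ∀ hn : (p : ℝ) < n,
      (SimpleGraph.binomialRandom (Fin n) (edgeProb p n hn)).real
        {H | ε ≤ |∫ x, x ^ k ∂(esd (X n H)) - gwMoment p c k|} ≤ R / n := by
  refine ⟨p * (4 * k) ^ 2 / (ε / 2 / 2) ^ 2, ?_⟩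
  have hlim : Tendsto (fun n : ℕ => (k * C * (1 + C) ^ k) / (n : ℝ)) atTop (𝓝 0) :=
    tendsto_const_div_atTop_nhds_zero_nat _
  filter_upwards [prob_abs_trace_sub_ge_le p c k (half_pos hε), eventually_gt_atTop 0,
    hlim.eventually (gt_mem_nhds (half_pos hε))] with n h1 hn0 h2 hn
  refine (measureReal_mono (fun H hH => ?_) (measure_ne_top _ _)).trans (h1 hn)
  simp only [Set.mem_ofPred_eq] at hH ⊢
  have hn0' : (0 : ℝ) < n := by exact_mod_cast hn0
  have : Nonempty (Fin n) := ⟨⟨0, hn0⟩⟩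
  rw [(esd_spec_of_abs_sub_le hX hXC hn0 H).2.2] at hH
  have h3 := abs_trace_pow_sub_matK_le c H hC (by simpa using hXC n H) k
  have h4 : |(X n H ^ k).trace / n - (matK c H ^ k).trace / n| < ε / 2 := by
    rw [← sub_div, abs_div, abs_of_pos hn0']
    exact (div_le_div_of_nonneg_right h3 hn0'.le).trans_lt h2
  have h5 := abs_sub_le ((X n H ^ k).trace / n) ((matK c H ^ k).trace / n) (gwMoment p c k)
  linarith

theorem prob_abs_integral_sub_ge_le [IsProbabilityMeasure μ] (p : ℝ≥0) (hC : 0 ≤ C)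
    (hX : ∀ n H, Symmetrizable (X n H))
    (hXC : ∀ n H i j, |(X n H - matK c H) i j| ≤ C / n)
    (hμ : μ (Set.Icc (-(1 + C)) (1 + C))ᶜ = 0) (hm : ∀ k, ∫ x, x ^ k ∂μ = gwMoment p c k)
    (f : ℝ →ᵇ ℝ) {ε : ℝ} (hε : 0 < ε) :
    ∃ R : ℝ, ∀ᶠ n : ℕ in atTop, ∀ hn : (p : ℝ) < n,
      (SimpleGraph.binomialRandom (Fin n) (edgeProb p n hn)).real
        {H | ε ≤ |∫ x, f x ∂(esd (X n H)) - ∫ x, f x ∂μ|} ≤ R / n := by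
  obtain ⟨N, δ, hδ, hctl⟩ := exists_moment_control (1 + C) f hε
  choose R hR using fun k => prob_abs_moment_sub_ge_le p hC hX hXC k hδ
  refine ⟨∑ k ∈ Finset.range N, R k, ?_⟩
  filter_upwards [(Finset.eventually_all (Finset.range N)).2 fun k _ => hR k,
    eventually_gt_atTop 0] with n h1 hn0 hn
  have hsub : {H : SimpleGraph (Fin n) | ε ≤ |∫ x, f x ∂(esd (X n H)) - ∫ x, f x ∂μ|} ⊆
      ⋃ k ∈ Finset.range N, {H | δ ≤ |∫ x, x ^ k ∂(esd (X n H)) - gwMoment p c k|} := by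
    intro H hH
    by_contra h2
    simp only [Set.mem_iUnion, Set.mem_ofPred_eq, not_exists, not_le, Finset.mem_range] at h2 hH
    obtain ⟨h3, h4, -⟩ := esd_spec_of_abs_sub_le hX hXC hn0 H
    exact absurd (hctl (esd (X n H)) μ h4 hμ fun k hk => by rw [hm]; exact h2 k hk) (not_lt.2 hH)
  refine (measureReal_mono hsub (measure_ne_top _ _)).trans
    ((measureReal_biUnion_finset_le _ _).trans ?_)
  rw [Finset.sum_div]
  exact Finset.sum_le_sum fun k hk => h1 k hk hn

variable {Ω : Type*} [MeasurableSpace Ω] {P : Measure Ω} [IsProbabilityMeasure P]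
  {G : (n : ℕ) → Ω → SimpleGraph (Fin n)}

theorem measure_preimage_le (hG : IsErdosRenyi P p G) {n : ℕ} (hn : (p : ℝ) < n)
    {A : Set (SimpleGraph (Fin n))} {r : ℝ}
    (h : (SimpleGraph.binomialRandom (Fin n) (edgeProb p n hn)).real A ≤ r) :
    P {ω | G n ω ∈ A} ≤ ENNReal.ofReal r := by
  rw [(hG n hn).measure_eq (p := fun H => H ∈ A) (Set.toFinite _).measurableSet]
  exact (ENNReal.le_ofReal_iff_toReal_le (measure_ne_top _ _)
    (measureReal_nonneg.trans h)).2 h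

/-- Deviation probabilities of order `1 / n` are summable along the subsequences in question. -/
theorem ae_eventually_notMem_of_le (hG : IsErdosRenyi P p G) {s : ℕ → ℕ} (hs : StrictMono s)
    (hsum : Summable fun j => 1 / (s j : ℝ)) {A : (n : ℕ) → Set (SimpleGraph (Fin n))} {R : ℝ}
    (h : ∀ᶠ n : ℕ in atTop, ∀ hn : (p : ℝ) < n,
      (SimpleGraph.binomialRandom (Fin n) (edgeProb p n hn)).real (A n) ≤ R / n) :
    ∀ᵐ ω ∂P, ∀ᶠ j in atTop, G (s j) ω ∉ A (s j) := by
  have h1 := hs.tendsto_atTop.eventually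
    (h.and (tendsto_natCast_atTop_atTop.eventually (eventually_gt_atTop (p : ℝ))))
  obtain ⟨J, hJ⟩ := eventually_atTop.1 h1
  have h2 : ∀ᵐ ω ∂P, ∀ᶠ j in atTop, ω ∉ {ω | G (s (j + J)) ω ∈ A (s (j + J))} := by
    refine ae_eventually_notMem (ne_top_of_le_ne_top
      (((summable_nat_add_iff J).2 (hsum.mul_left R)).tsum_ofReal_ne_top)
      (ENNReal.tsum_le_tsum fun j => ?_))
    obtain ⟨h3, h4⟩ := hJ (j + J) (by omega)
    refine measure_preimage_le hG h4 ((h3 h4).trans_eq ?_)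
    rw [mul_one_div]
  filter_upwards [h2] with ω hω
  rw [← map_add_atTop_eq_nat J, eventually_map]
  exact hω

theorem esdConverges_of_abs_sub_le [IsProbabilityMeasure μ] (hC : 0 ≤ C)
    (hX : ∀ n H, Symmetrizable (X n H))
    (hXC : ∀ n H i j, |(X n H - matK c H) i j| ≤ C / n)
    (hμ : μ (Set.Icc (-1) 1)ᶜ = 0) (hm : ∀ k, ∫ x, x ^ k ∂μ = gwMoment p c k)
    (hG : IsErdosRenyi P p G) : EsdConverges P G X μ := by
  have hμ' : μ (Set.Icc (-(1 + C)) (1 + C))ᶜ = 0 :=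
    measure_mono_null (Set.compl_subset_compl.2 (Set.Icc_subset_Icc (by linarith) (by linarith)))
      hμ
  constructor
  · intro f
    rw [tendstoInMeasure_iff_dist]
    intro ε hε
    obtain ⟨R, hR⟩ := prob_abs_integral_sub_ge_le p hC hX hXC hμ' hm f hε
    have hlim : Tendsto (fun n : ℕ => ENNReal.ofReal (R / n)) atTop (𝓝 0) := by
      simpa using ENNReal.tendsto_ofReal (tendsto_const_div_atTop_nhds_zero_nat R)
    refine tendsto_of_tendsto_of_tendsto_of_le_of_le' tendsto_const_nhds hlim
      (Eventually.of_forall fun _ => zero_le) ?_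
    filter_upwards [hR, tendsto_natCast_atTop_atTop.eventually (eventually_gt_atTop (p : ℝ))]
      with n h1 hn
    exact measure_preimage_le hG hn (h1 hn)
  · intro s hs hsum
    have h1 : ∀ᵐ ω ∂P, ∀ k i : ℕ, ∀ᶠ j in atTop,
        |∫ x, x ^ k ∂(esd (X (s j) (G (s j) ω))) - gwMoment p c k| < 1 / ((i : ℝ) + 1) := by
      rw [ae_all_iff]
      intro k
      rw [ae_all_iff]
      intro i
      obtain ⟨R, hR⟩ := prob_abs_moment_sub_ge_le p hC hX hXC k
        (ε := 1 / ((i : ℝ) + 1)) (by positivity)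
      filter_upwards [ae_eventually_notMem_of_le hG hs hsum hR] with ω hω
      filter_upwards [hω] with j hj
      simpa using hj
    filter_upwards [h1] with ω hω f
    rw [Metric.tendsto_atTop']
    intro ε hε
    obtain ⟨N, δ, hδ, hctl⟩ := exists_moment_control (1 + C) f hε
    obtain ⟨i, hi⟩ := exists_nat_one_div_lt hδ
    have h2 := (((Finset.eventually_all (Finset.range N)).2 fun k _ => hω k i).and
      (hs.tendsto_atTop.eventually (eventually_gt_atTop 0)))
    obtain ⟨J, hJ⟩ := eventually_atTop.1 h2
    refine ⟨J, fun j hj => ?_⟩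
    obtain ⟨h3, h4⟩ := hJ j hj.le
    obtain ⟨h5, h6, -⟩ := esd_spec_of_abs_sub_le hX hXC h4 (G (s j) ω)
    rw [Real.dist_eq]
    exact hctl _ μ h6 hμ' fun k hk => by
      rw [hm]; exact (h3 k (Finset.mem_range.2 hk)).trans hi

end Convergence

end RandomMarkov

theorem mainTheorem2 (p : ℝ≥0) (hp : 0 < p) (c : ℝ≥0) :
    -- all eigenvalues of the matrices are real
    (∀ (n : ℕ) (H : SimpleGraph (Fin n)),
      (RandomMarkov.matK c H).charpoly.Splits ∧
      (RandomMarkov.matM' c H).charpoly.Splits ∧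
      (0 < c → (RandomMarkov.matM c H).charpoly.Splits)) ∧
    ∃ μ : Measure ℝ, IsProbabilityMeasure μ ∧
      -- convergence of the spectral distributions
      (∀ (Ω : Type*) [MeasurableSpace Ω] (P : Measure Ω) [IsProbabilityMeasure P]
        (G : (n : ℕ) → Ω → SimpleGraph (Fin n)), RandomMarkov.IsErdosRenyi P p G →
          RandomMarkov.EsdConverges P G (fun _ H => RandomMarkov.matK c H) μ ∧
          RandomMarkov.EsdConverges P G (fun _ H => RandomMarkov.matM' c H) μ ∧
          (0 < c → RandomMarkov.EsdConverges P G (fun _ H => RandomMarkov.matM c H) μ)) ∧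
      -- symmetric
      μ.map (fun x => -x) = μ ∧
      -- nondegenerate
      (∀ a : ℝ, μ ≠ Measure.dirac a) ∧
      -- moments
      ∀ k : ℕ, 1 ≤ k →
        Integrable (fun x : ℝ => x ^ k) μ ∧
        Integrable (RandomMarkov.gwReturnProb c k) (RandomMarkov.offspringLaw p) ∧
        ∫ x, x ^ k ∂μ = ∫ ξ, RandomMarkov.gwReturnProb c k ξ ∂(RandomMarkov.offspringLaw p) := by
  obtain ⟨μ, hμ, hsupp, hm⟩ := RandomMarkov.exists_limit_measure p c
  -- reflection changes the sign of the odd moments, which vanish because trees are bipartite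
  have hsymm : μ.map (fun x => -x) = μ := by
    have hneg : Measurable fun x : ℝ => -x := measurable_neg
    have : IsProbabilityMeasure (μ.map fun x => -x) :=
      Measure.isProbabilityMeasure_map hneg.aemeasurable
    refine RandomMarkov.measure_eq_of_moments_eq (B := 1) ?_ hsupp fun k => ?_
    · rw [Measure.map_apply hneg measurableSet_Icc.compl]
      convert hsupp using 2
      ext x
      simp only [Set.mem_preimage, Set.mem_compl_iff, Set.mem_Icc]
      exact not_congr ⟨fun h => ⟨by linarith [h.2], by linarith [h.1]⟩,
        fun h => ⟨by linarith [h.2], by linarith [h.1]⟩⟩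
    · rw [integral_map hneg.aemeasurable (continuous_pow k).aestronglyMeasurable]
      rcases Nat.even_or_odd k with hk | hk
      · simp_rw [hk.neg_pow]
      · simp_rw [hk.neg_pow]
        rw [integral_neg, hm, RandomMarkov.gwMoment_odd p c hk, neg_zero]
  refine ⟨fun n H => ⟨(RandomMarkov.symmetrizable_matK c H).splits,
    (RandomMarkov.symmetrizable_matM' c H).splits,
    fun hc => (RandomMarkov.symmetrizable_matM c H hc).splits⟩, μ, hμ, ?_, hsymm, ?_, ?_⟩
  · intro Ω _ P _ G hG
    refine ⟨?_, ?_, fun hc => ?_⟩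
    · exact RandomMarkov.esdConverges_of_abs_sub_le (C := 0) le_rfl
        (fun _ H => RandomMarkov.symmetrizable_matK c H) (fun n H i j => by simp) hsupp hm hG
    · exact RandomMarkov.esdConverges_of_abs_sub_le (C := c) c.2
        (fun _ H => RandomMarkov.symmetrizable_matM' c H)
        (fun n H i j => by simpa using RandomMarkov.abs_matM'_sub_matK_le c H i j) hsupp hm hG
    · exact RandomMarkov.esdConverges_of_abs_sub_le (C := 1) zero_le_one
        (fun _ H => RandomMarkov.symmetrizable_matM c H hc)
        (fun n H i j => by simpa using RandomMarkov.abs_matM_sub_matK_le c H hc i j) hsupp hm hG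
  · rintro a rfl
    have h1 := hm 1
    have h2 := hm 2
    rw [RandomMarkov.gwMoment_odd p c odd_one, integral_dirac, pow_one] at h1
    rw [integral_dirac, h1] at h2
    have := RandomMarkov.gwMoment_two_pos hp c
    norm_num at h2
    linarith
  · exact fun k _ => ⟨RandomMarkov.integrable_of_continuous hsupp (continuous_pow k),
      RandomMarkov.integrable_gwReturnProb p c k, hm k⟩
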